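/- Let $\alpha>0$ be a non-integer and let $\gamma,k_l,k_s,d_l,d_s,T_i,T_\infty,h_0>0$. Consider the two-phase Stefan problem of finding $s(t)$, $\Psi_l(x,t)$, $\Psi_s(x,t)$, with $s(t)>0$ for $t>0$, such that $$\begin{aligned} &\Psi_{l,t}=d_l\Psi_{l,xx}\quad (0<x<s(t),\ t>0),\qquad \Psi_{s,t}=d_s\Psi_{s,xx}\quad (x>s(t),\ t>0),\\ &s(0)=0,\qquad \Psi_l(s(t),t)=\Psi_s(s(t),t)=0\quad (t>0),\\ &k_s\Psi_{s,x}(s(t),t)-k_l\Psi_{l,x}(s(t),t)=\gamma\, s(t)^{\alpha}\dot s(t)\quad (t>0),\\ &k_l\Psi_{l,x}(0,t)=h_0t^{-1/2}\left[\Psi_l(0,t)-T_\infty t^{\alpha/2}\right]\quad (t>0),\\ &\Psi_s(x,0)=\lim_{t\to0^+}\Psi_s(x,t)=-T_ix^{\alpha}\quad (x>0). \end{aligned}$$ Solutions are classical: $s$ is continuous on $[0,\infty)$ and differentiable on $(0,\infty)$, inside each phase the temperature is $C^2$ in $x$ and differentiable in $t$, and the derivatives at $x=0$ and $x=s(t)$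 are one-sided. A solution is of similarity type if, in the closure of the respective phase for $t>0$, $\Psi_l(x,t)=t^{\alpha/2}f_l\big(x/(2\sqrt{d_lt})\big)$ and $\Psi_s(x,t)=t^{\alpha/2}f_s\big(x/(2\sqrt{d_st})\big)$ for some real functions $f_l,f_s$. Let $M(a,b,z)=\sum_{n\ge0}\frac{(a)_n}{(b)_n\,n!}z^n$, with $(a)_n=a(a+1)\cdots(a+n-1)$ and $(a)_0=1$, and $U(a,b,z)=\frac{\Gamma(1-b)}{\Gamma(a-b+1)}M(a,b,z)+\frac{\Gamma(b-1)}{\Gamma(a)}z^{1-b}M(a-b+1,2-b,z)$ be the Kummer functions, and let $\omega=\sqrt{d_l/d_s}$. Suppose that $$h_0>\frac{2^{\alpha}\,\Gamma\!\left(\frac{\alpha}{2}+1\right)k_sT_i\,d_s^{(\alpha-1)/2}}{T_\infty\sqrt{\pi}}.$$ Then the equation $$-\frac{k_sT_id_s^{(\alpha-1)/2}}{\gamma d_l^{(\alpha+1)/2}}\cdot\frac{1}{U\!\left(\frac{\alpha}{2}+\frac12,\frac12,x^2\omega^2\right)}+\frac{h_0T_\infty}{\gamma2^{\alpha}d_l^{(\alpha+1)/2}}\cdot\frac{1}{M\!\left(\frac{\alpha}{2}+\frac12,\frac12,x^2\right)+\frac{2\sqrt{d_l}\,h_0}{k_l}\,x\,M\!\left(\frac{\alpha}{2}+1,\frac32,x^2\right)}=x^{\alpha+1}$$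 has a unique positive root $x=\nu$. The Stefan problem has a unique solution of similarity type (unique as to $s$ for $t\ge0$ and as to $\Psi_l$, $\Psi_s$ on the closures of their phases for $t>0$); melting starts instantaneously, i.e. $s(t)>0$ for all $t>0$; and the solution is, for $t>0$, $$s(t)=2\nu\sqrt{d_lt},\qquad \Psi_j(x,t)=t^{\alpha/2}\left[E_jM\!\left(-\tfrac{\alpha}{2},\tfrac12,-\eta_j^2\right)+F_j\,\eta_j\,M\!\left(-\tfrac{\alpha}{2}+\tfrac12,\tfrac32,-\eta_j^2\right)\right],\qquad \eta_j=\frac{x}{2\sqrt{d_jt}},\quad j\in\{l,s\},$$ where $$\begin{aligned} E_l&=\frac{-\nu M\left(-\frac{\alpha}{2}+\frac12,\frac32,-\nu^2\right)}{M\left(-\frac{\alpha}{2},\frac12,-\nu^2\right)}F_l,& F_l&=\frac{-2h_0T_\infty\sqrt{d_l}\,M\left(-\frac{\alpha}{2},\frac12,-\nu^2\right)}{k_lM\left(-\frac{\alpha}{2},\frac12,-\nu^2\right)+2\sqrt{d_l}\,h_0\,\nu M\left(-\frac{\alpha}{2}+\frac12,\frac32,-\nu^2\right)},\\ E_s&=\frac{-\nu\omega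 M\left(-\frac{\alpha}{2}+\frac12,\frac32,-\nu^2\omega^2\right)}{M\left(-\frac{\alpha}{2},\frac12,-\nu^2\omega^2\right)}F_s,& F_s&=\frac{-T_i2^{\alpha+1}d_s^{\alpha/2}M\left(\frac{\alpha}{2}+\frac12,\frac12,\nu^2\omega^2\right)}{U\left(\frac{\alpha}{2}+\frac12,\frac12,\nu^2\omega^2\right)}. \end{aligned}$$ -/

import Mathlib

open Set Filter Topology

noncomputable section

/-- The Kummer function `M(a,b,z) = ∑ (a)_n / ((b)_n n!) z^n` for real arguments
(`b` not a nonpositive integer); `(a)_n` is the rising factorial. -/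
def kummerM (a b z : ℝ) : ℝ :=
  ∑' n : ℕ, (ascPochhammer ℝ n).eval a / ((ascPochhammer ℝ n).eval b * (n.factorial : ℝ)) * z ^ n

/-- The Kummer function `U(a,b,z)` for real arguments (`b` not an integer, `0 ≤ z`):
`Γ(1-b)/Γ(a-b+1) M(a,b,z) + Γ(b-1)/Γ(a) z^(1-b) M(a-b+1,2-b,z)`. -/
def kummerU (a b z : ℝ) : ℝ :=
  Real.Gamma (1 - b) / Real.Gamma (a - b + 1) * kummerM a b z
    + Real.Gamma (b - 1) / Real.Gamma a * z ^ (1 - b) * kummerM (a - b + 1) (2 - b) z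

/-- The numerical data of the two-phase Stefan problem: exponent `α` and coefficient `γ` of the
latent heat `γ x^α`, conductivities `kl`, `ks` and diffusivities `dl`, `ds` of the liquid and the
solid phase, initial temperature coefficient `Ti`, bulk temperature coefficient `Tinf` and heat
transfer coefficient `h0`. -/
structure StefanData where
  α : ℝ
  γ : ℝ
  kl : ℝ
  ks : ℝ
  dl : ℝ
  ds : ℝ
  Ti : ℝ
  Tinf : ℝ
  h0 : ℝ

namespace StefanData

variable (p : StefanData)

/-- A classical solution of the free boundary problem. The liquid occupies `0 ≤ x ≤ s t`, the
solid `x ≥ s t`, at times `t > 0`. Values of `Ψl` and `Ψs` outside their phases are irrelevant.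
Space derivatives at the boundary of a phase are one-sided, taken from inside the phase; the
initial temperature is attained as a limit for `t → 0+`. -/
structure IsSolution (s : ℝ → ℝ) (Ψl Ψs : ℝ → ℝ → ℝ) : Prop where
  front_zero : s 0 = 0
  front_pos : ∀ t, 0 < t → 0 < s t
  front_continuous : ContinuousOn s (Ici 0)
  front_differentiable : ∀ t, 0 < t → DifferentiableAt ℝ s t
  liquid_regular_x : ∀ t, 0 < t → ∀ x, 0 < x → x < s t → ContDiffAt ℝ 2 (fun y => Ψl y t) x
  liquid_regular_t : ∀ t, 0 < t → ∀ x, 0 < x → x < s t →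
    DifferentiableAt ℝ (fun τ => Ψl x τ) t
  liquid_heat : ∀ t, 0 < t → ∀ x, 0 < x → x < s t →
    deriv (fun τ => Ψl x τ) t = p.dl * iteratedDeriv 2 (fun y => Ψl y t) x
  solid_regular_x : ∀ t, 0 < t → ∀ x, s t < x → ContDiffAt ℝ 2 (fun y => Ψs y t) x
  solid_regular_t : ∀ t, 0 < t → ∀ x, s t < x → DifferentiableAt ℝ (fun τ => Ψs x τ) t
  solid_heat : ∀ t, 0 < t → ∀ x, s t < x →
    deriv (fun τ => Ψs x τ) t = p.ds * iteratedDeriv 2 (fun y => Ψs y t) x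
  liquid_front : ∀ t, 0 < t → Ψl (s t) t = 0
  solid_front : ∀ t, 0 < t → Ψs (s t) t = 0
  liquid_diff_front : ∀ t, 0 < t →
    DifferentiableWithinAt ℝ (fun y => Ψl y t) (Icc 0 (s t)) (s t)
  solid_diff_front : ∀ t, 0 < t →
    DifferentiableWithinAt ℝ (fun y => Ψs y t) (Ici (s t)) (s t)
  stefan : ∀ t, 0 < t →
    p.ks * derivWithin (fun y => Ψs y t) (Ici (s t)) (s t)
      - p.kl * derivWithin (fun y => Ψl y t) (Icc 0 (s t)) (s t)
      = p.γ * s t ^ p.α * deriv s t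
  liquid_diff_face : ∀ t, 0 < t →
    DifferentiableWithinAt ℝ (fun y => Ψl y t) (Icc 0 (s t)) 0
  convective : ∀ t, 0 < t →
    p.kl * derivWithin (fun y => Ψl y t) (Icc 0 (s t)) 0
      = p.h0 * t ^ (-(1 / 2) : ℝ) * (Ψl 0 t - p.Tinf * t ^ (p.α / 2))
  initial : ∀ x, 0 < x → Tendsto (fun t => Ψs x t) (𝓝[>] 0) (𝓝 (-p.Ti * x ^ p.α))

/-- Similarity type: in its phase, each temperature is `t^(α/2)` times a function of the
similarity variable `x / (2 √(d t))`. Nothing is imposed on the form of the front `s`. -/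
def IsSimilarityType (s : ℝ → ℝ) (Ψl Ψs : ℝ → ℝ → ℝ) : Prop :=
  ∃ fl fs : ℝ → ℝ, ∀ t, 0 < t →
    (∀ x, 0 ≤ x → x ≤ s t → Ψl x t = t ^ (p.α / 2) * fl (x / (2 * √(p.dl * t)))) ∧
    (∀ x, s t ≤ x → Ψs x t = t ^ (p.α / 2) * fs (x / (2 * √(p.ds * t))))

/-- `ω = √(dl/ds)`. -/
def ω : ℝ := √(p.dl / p.ds)

def f₁ (x : ℝ) : ℝ := 1 / kummerU (p.α / 2 + 1 / 2) (1 / 2) (x ^ 2 * p.ω ^ 2)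

def f₂ (x : ℝ) : ℝ :=
  1 / (kummerM (p.α / 2 + 1 / 2) (1 / 2) (x ^ 2)
    + 2 * (√p.dl * p.h0 / p.kl) * x * kummerM (p.α / 2 + 1) (3 / 2) (x ^ 2))

/-- The equation for the dimensionless front coefficient. -/
def FrontEquation (x : ℝ) : Prop :=
  -(p.ks * p.Ti * p.ds ^ ((p.α - 1) / 2) / (p.γ * p.dl ^ ((p.α + 1) / 2))) * p.f₁ x
    + p.h0 * p.Tinf / (p.γ * (2 : ℝ) ^ p.α * p.dl ^ ((p.α + 1) / 2)) * p.f₂ x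
    = x ^ (p.α + 1)

def Fl (ν : ℝ) : ℝ :=
  -p.h0 * p.Tinf * 2 * √p.dl * kummerM (-p.α / 2) (1 / 2) (-ν ^ 2) /
    (p.kl * kummerM (-p.α / 2) (1 / 2) (-ν ^ 2)
      + 2 * √p.dl * p.h0 * ν * kummerM (-p.α / 2 + 1 / 2) (3 / 2) (-ν ^ 2))

def El (ν : ℝ) : ℝ :=
  -ν * kummerM (-p.α / 2 + 1 / 2) (3 / 2) (-ν ^ 2) / kummerM (-p.α / 2) (1 / 2) (-ν ^ 2) * p.Fl ν

def Fs (ν : ℝ) : ℝ :=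
  -p.Ti * (2 : ℝ) ^ (p.α + 1) * p.ds ^ (p.α / 2)
      * kummerM (p.α / 2 + 1 / 2) (1 / 2) (ν ^ 2 * p.ω ^ 2) /
    kummerU (p.α / 2 + 1 / 2) (1 / 2) (ν ^ 2 * p.ω ^ 2)

def Es (ν : ℝ) : ℝ :=
  -ν * p.ω * kummerM (-p.α / 2 + 1 / 2) (3 / 2) (-(ν ^ 2 * p.ω ^ 2)) /
    kummerM (-p.α / 2) (1 / 2) (-(ν ^ 2 * p.ω ^ 2)) * p.Fs ν

/-- `t^(α/2) [E M(-α/2, 1/2, -η²) + F η M(-α/2 + 1/2, 3/2, -η²)]` with `η = x / (2 √(d t))`. -/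
def kummerTemperature (α d E F x t : ℝ) : ℝ :=
  t ^ (α / 2) *
    (E * kummerM (-α / 2) (1 / 2) (-(x / (2 * √(d * t))) ^ 2)
      + F * (x / (2 * √(d * t))) * kummerM (-α / 2 + 1 / 2) (3 / 2) (-(x / (2 * √(d * t))) ^ 2))

/-- The explicit front with coefficient `ν`. -/
def front (ν t : ℝ) : ℝ := 2 * ν * √(p.dl * t)

/-- The explicit liquid temperature. -/
def liquid (ν x t : ℝ) : ℝ := kummerTemperature p.α p.dl (p.El ν) (p.Fl ν) x t

/-- The explicit solid temperature. -/
def solid (ν x t : ℝ) : ℝ := kummerTemperature p.α p.ds (p.Es ν) (p.Fs ν) x t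

end StefanData

end

/-!
# The two-phase Stefan problem with power-law latent heat and a convective boundary condition

A function `t^(α/2) f(x / (2 √(d t)))` solves the heat equation with diffusivity `d` exactly if its
profile `f` solves the similarity equation `f'' = 2 α f - 2 η f'`. The solution space is spanned by
`evenSol` and `oddSol`, the two functions in the claimed formulas, and their Wronskian is `e^{-η²}`.
Comparing initial values at `0` identifies other solutions with combinations of these two. This
gives Kummer's transformation (`evenSol_eq`, `oddSol_eq`), and for
`L(x) = ∫₀^∞ u^α e^{-u² - 2ux} du` (`gaussLaplace`) it expresses `e^{-x²} L(x)` and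
`e^{-x²} L(-x)` through the even and odd solutions (`exp_mul_gaussLaplace_eq`). The integral makes
everything needed about `U` visible:

* `U(α/2 + 1/2, 1/2, x²)` is a positive multiple of `L(x)` (`kummerU_sq`), so it is positive and
  strictly decreasing for `x ≥ 0`;
* `oddSol / evenSol = const · (L(-x) - L(x)) / (L(-x) + L(x))` is strictly increasing
  (`oddSol_mul_evenSol_lt`), so a nontrivial profile has at most one zero;
* `e^{-x²} L(-x) ∼ √π x^α` whereas `e^{-x²} L(x)` is negligible, so the initial condition is one
  linear equation for the two coefficients of the solid profile
  (`tendsto_linearCombination_div_rpow`).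

The front equation has the form `-C₁ f₁ + C₂ f₂ = x^(α+1)` with `f₁` increasing, `f₂` decreasing and
both sides continuous; the hypothesis on `h0` says that the left side is positive at `x = 0`. Hence
there is exactly one positive root.

For a profile vanishing at the front, the remaining condition (convective or initial) fixes both
coefficients (`liquid_conditions_iff`, `solid_conditions_iff`), the slope at the front follows from
the Wronskian, and the Stefan condition becomes the front equation (`stefan_iff`). As these are
equivalences they prove existence and uniqueness alike. For uniqueness the front is not assumed to
be of the form `c √t`: the liquid profile vanishes at `s t / (2 √(dl t))` for every `t`, it is
nontrivial because of the convective condition, and having only one zero it forces this quotient to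
be constant (`IsSolution.exists_front`).
-/

noncomputable section

/-! ### The Kummer series -/

/-- The `n`-th coefficient of the power series `M(a,b,·)`. -/
def kummerCoeff (a b : ℝ) (n : ℕ) : ℝ :=
  (ascPochhammer ℝ n).eval a / ((ascPochhammer ℝ n).eval b * (n.factorial : ℝ))

theorem kummerM_eq_tsum (a b z : ℝ) : kummerM a b z = ∑' n, kummerCoeff a b n * z ^ n := rfl

theorem kummerCoeff_zero (a b : ℝ) : kummerCoeff a b 0 = 1 := by
  simp [kummerCoeff]

theorem kummerCoeff_succ (a : ℝ) {b : ℝ} (hb : 0 < b) (n : ℕ) :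
    (n + 1) * (b + n) * kummerCoeff a b (n + 1) = (a + n) * kummerCoeff a b n := by
  have h1 : (ascPochhammer ℝ n).eval b ≠ 0 := (ascPochhammer_pos n b hb).ne'
  have h2 : (n.factorial : ℝ) ≠ 0 := by positivity
  have h3 : b + n ≠ 0 := by positivity
  have h4 : (n : ℝ) + 1 ≠ 0 := by positivity
  simp only [kummerCoeff, ascPochhammer_succ_eval, Nat.factorial_succ, Nat.cast_mul,
    Nat.cast_add, Nat.cast_one]
  field_simp

theorem kummerCoeff_succ_shift (a : ℝ) {b : ℝ} (hb : 0 < b) (n : ℕ) :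
    (n + 1) * kummerCoeff a b (n + 1) = a / b * kummerCoeff (a + 1) (b + 1) n := by
  have h1 : (ascPochhammer ℝ n).eval (b + 1) ≠ 0 := (ascPochhammer_pos n _ (by positivity)).ne'
  have h2 : (n.factorial : ℝ) ≠ 0 := by positivity
  have h4 : (n : ℝ) + 1 ≠ 0 := by positivity
  simp only [kummerCoeff, ascPochhammer_succ_left, Nat.factorial_succ, Nat.cast_mul,
    Nat.cast_add, Nat.cast_one, Polynomial.eval_mul, Polynomial.eval_X, Polynomial.eval_comp,
    Polynomial.eval_add, Polynomial.eval_one]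
  field_simp

theorem kummerCoeff_pos {a b : ℝ} (ha : 0 < a) (hb : 0 < b) (n : ℕ) : 0 < kummerCoeff a b n := by
  have h1 := ascPochhammer_pos n b hb
  have h2 := ascPochhammer_pos n a ha
  unfold kummerCoeff
  positivity

theorem summable_kummerCoeff (a : ℝ) {b : ℝ} (hb : 0 < b) (z : ℝ) :
    Summable fun n => kummerCoeff a b n * z ^ n := by
  refine summable_of_ratio_norm_eventually_le (r := 1 / 2) (by norm_num) ?_
  have hlim : Tendsto (fun n : ℕ => (|a| / b + 1) * |z| / ((n : ℝ) + 1)) atTop (𝓝 0) :=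
    (tendsto_const_nhds).div_atTop
      (tendsto_atTop_add_const_right _ _ tendsto_natCast_atTop_atTop)
  filter_upwards [hlim.eventually_le_const (show (0 : ℝ) < 1 / 2 by norm_num)] with n hn
  have h3 : 0 < b + n := by positivity
  have h4 : (0 : ℝ) < (n : ℝ) + 1 := by positivity
  have hc : kummerCoeff a b (n + 1) = (a + n) / ((n + 1) * (b + n)) * kummerCoeff a b n := by
    have := kummerCoeff_succ a hb n
    field_simp
    linarith
  have hq : |a + n| / (b + n) ≤ |a| / b + 1 := by
    rw [div_le_iff₀ h3]
    have h5 : |a + n| ≤ |a| + n := (abs_add_le _ _).trans (by simp)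
    have h6 : |a| / b * b = |a| := by field_simp
    have h7 : 0 ≤ |a| / b * n := by positivity
    nlinarith
  rw [hc, pow_succ]
  simp only [norm_mul, Real.norm_eq_abs, abs_div, abs_of_pos (mul_pos h4 h3)]
  calc |a + n| / ((n + 1) * (b + n)) * |kummerCoeff a b n| * (|z ^ n| * |z|)
      = (|a + n| / (b + n)) * |z| / (n + 1) * (|kummerCoeff a b n| * |z ^ n|) := by
        field_simp
    _ ≤ (|a| / b + 1) * |z| / (n + 1) * (|kummerCoeff a b n| * |z ^ n|) := by gcongr
    _ ≤ 1 / 2 * (|kummerCoeff a b n| * |z ^ n|) := by gcongr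

theorem hasSum_kummerM (a : ℝ) {b : ℝ} (hb : 0 < b) (z : ℝ) :
    HasSum (fun n => kummerCoeff a b n * z ^ n) (kummerM a b z) :=
  (summable_kummerCoeff a hb z).hasSum

theorem kummerM_zero (a b : ℝ) : kummerM a b 0 = 1 := by
  rw [kummerM_eq_tsum, tsum_eq_single 0]
  · simp [kummerCoeff_zero]
  · intro n hn
    simp [hn]

/-- The termwise derivative of the Kummer series is again a Kummer series. -/
theorem hasSum_kummerM_deriv (a : ℝ) {b : ℝ} (hb : 0 < b) (z : ℝ) :
    HasSum (fun n : ℕ => kummerCoeff a b n * (n * z ^ (n - 1)))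
      (a / b * kummerM (a + 1) (b + 1) z) := by
  rw [← hasSum_nat_add_iff' 1]
  simp only [Finset.sum_range_one, Nat.cast_zero, zero_mul, mul_zero, sub_zero]
  refine ((hasSum_kummerM (a + 1) (b := b + 1) (by positivity) z).mul_left (a / b)).congr_fun ?_
  intro n
  have := kummerCoeff_succ_shift a hb n
  rw [← mul_assoc (a / b), ← this]
  push_cast
  ring

theorem hasDerivAt_kummerM (a : ℝ) {b : ℝ} (hb : 0 < b) (z : ℝ) :
    HasDerivAt (kummerM a b) (a / b * kummerM (a + 1) (b + 1) z) z := by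
  have hR : 0 < |z| + 1 := by positivity
  have hsum := (hasSum_kummerM_deriv a hb z).tsum_eq
  rw [← hsum]
  have habs : Summable fun n : ℕ => |kummerCoeff a b n * (n * (|z| + 1) ^ (n - 1))| :=
    (hasSum_kummerM_deriv a hb (|z| + 1)).summable.abs
  refine hasDerivAt_tsum_of_isPreconnected (t := Metric.ball 0 (|z| + 1)) (y₀ := 0)
    (g := fun n y => kummerCoeff a b n * y ^ n)
    (g' := fun n y => kummerCoeff a b n * (n * y ^ (n - 1))) habs
    Metric.isOpen_ball (convex_ball _ _).isPreconnected ?_ ?_ ?_ ?_ ?_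
  · intro n y _
    exact (hasDerivAt_pow n y).const_mul _
  · intro n y hy
    rw [mem_ball_zero_iff, Real.norm_eq_abs] at hy
    simp only [norm_mul, norm_pow, Real.norm_eq_abs, abs_mul, abs_pow, abs_of_pos hR]
    gcongr
  · exact Metric.mem_ball_self hR
  · exact summable_kummerCoeff a hb 0
  · simp

theorem contDiff_kummerM (n : ℕ) (a : ℝ) {b : ℝ} (hb : 0 < b) : ContDiff ℝ n (kummerM a b) := by
  induction n generalizing a b with
  | zero =>
    exact contDiff_zero.2
      (continuous_iff_continuousAt.2 fun z => (hasDerivAt_kummerM a hb z).continuousAt)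
  | succ n ih =>
    have hd : deriv (kummerM a b) = fun z => a / b * kummerM (a + 1) (b + 1) z :=
      funext fun z => (hasDerivAt_kummerM a hb z).deriv
    push_cast
    refine contDiff_succ_iff_deriv.2
      ⟨fun z => (hasDerivAt_kummerM a hb z).differentiableAt, by simp, ?_⟩
    rw [hd]
    exact contDiff_const.mul (ih (a + 1) (by positivity))

theorem continuous_kummerM (a : ℝ) {b : ℝ} (hb : 0 < b) : Continuous (kummerM a b) :=
  (contDiff_kummerM 0 a hb).continuous

/-- Kummer's differential equation `z M'' + (b - z) M' = a M`, with the derivatives written as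
Kummer functions. -/
theorem kummerM_ode (a : ℝ) {b : ℝ} (hb : 0 < b) (z : ℝ) :
    z * (a / b * ((a + 1) / (b + 1) * kummerM (a + 1 + 1) (b + 1 + 1) z))
      + (b - z) * (a / b * kummerM (a + 1) (b + 1) z) = a * kummerM a b z := by
  have hz : ∀ (n : ℕ), z * (n * z ^ (n - 1)) = n * z ^ n := by
    rintro (_ | n)
    · simp
    · simp [pow_succ]; ring
  have h0 := (hasSum_kummerM a hb z).mul_left a
  have h1 := ((hasSum_kummerM (a + 1) (b := b + 1) (by positivity) z).mul_left (a / b)).mul_left b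
  have h2 := (hasSum_kummerM_deriv a hb z).mul_left z
  have h3 := ((hasSum_kummerM_deriv (a + 1) (b := b + 1) (by positivity) z).mul_left z).mul_left
    (a / b)
  have h := (h3.add h1).sub h2
  have key := h.unique (h0.congr_fun fun n => ?_)
  · linear_combination key
  · have e1 := kummerCoeff_succ_shift a hb n
    have e2 := kummerCoeff_succ a hb n
    have e3 := hz n
    linear_combination (-(kummerCoeff a b n) + a / b * kummerCoeff (a + 1) (b + 1) n) * e3
      - (n + b) * z ^ n * e1 + z ^ n * e2

theorem kummerM_monotoneOn {a b : ℝ} (ha : 0 < a) (hb : 0 < b) :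
    MonotoneOn (kummerM a b) (Ici 0) := by
  intro x hx y _ hxy
  refine (summable_kummerCoeff a hb x).tsum_le_tsum (fun n => ?_) (summable_kummerCoeff a hb y)
  have := kummerCoeff_pos ha hb n
  have hx' : 0 ≤ x := hx
  gcongr

theorem one_le_kummerM {a b z : ℝ} (ha : 0 < a) (hb : 0 < b) (hz : 0 ≤ z) : 1 ≤ kummerM a b z := by
  have := kummerM_monotoneOn ha hb (mem_Ici.2 le_rfl) (mem_Ici.2 hz) hz
  rwa [kummerM_zero] at this

/-! ### The similarity equation `y'' = 2 α y - 2 x y'` -/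

/-- `y` solves `y'' = 2 α y - 2 x y'` on `S`. This is the equation of the profile `y` of a
solution `t^(α/2) y(x / (2 √(d t)))` of the heat equation with diffusivity `d`. -/
structure SimilarityODE (α : ℝ) (S : Set ℝ) (y : ℝ → ℝ) : Prop where
  hasDerivAt : ∀ x ∈ S, HasDerivAt y (deriv y x) x
  hasDerivAt_deriv : ∀ x ∈ S, HasDerivAt (deriv y) (2 * α * y x - 2 * x * deriv y x) x

namespace SimilarityODE

variable {α : ℝ} {S : Set ℝ} {y z : ℝ → ℝ}

theorem of_hasDerivAt {y' : ℝ → ℝ} (h1 : ∀ x, HasDerivAt y (y' x) x)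
    (h2 : ∀ x, HasDerivAt y' (2 * α * y x - 2 * x * y' x) x) : SimilarityODE α univ y := by
  have hy : deriv y = y' := funext fun x => (h1 x).deriv
  exact ⟨fun x _ => by rw [hy]; exact h1 x, fun x _ => by rw [hy]; exact h2 x⟩

theorem mono {T : Set ℝ} (h : SimilarityODE α T y) (hST : S ⊆ T) : SimilarityODE α S y :=
  ⟨fun x hx => h.hasDerivAt x (hST hx), fun x hx => h.hasDerivAt_deriv x (hST hx)⟩

theorem deriv_linearCombination (hy : SimilarityODE α univ y) (hz : SimilarityODE α univ z)
    (A B x : ℝ) : HasDerivAt (fun x => A * y x + B * z x) (A * deriv y x + B * deriv z x) x :=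
  ((hy.hasDerivAt x trivial).const_mul A).add ((hz.hasDerivAt x trivial).const_mul B)

theorem linearCombination (hy : SimilarityODE α univ y) (hz : SimilarityODE α univ z)
    (A B : ℝ) : SimilarityODE α univ fun x => A * y x + B * z x :=
  of_hasDerivAt (hy.deriv_linearCombination hz A B) fun x =>
    (((hy.hasDerivAt_deriv x trivial).const_mul A).add
      ((hz.hasDerivAt_deriv x trivial).const_mul B)).congr_deriv (by ring)

/-- By Abel's formula the Wronskian of two solutions is a multiple of `e^{-x²}`. -/
theorem exists_wronskian_eq (hS : IsOpen S) (hS' : IsPreconnected S)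
    (hy : SimilarityODE α S y) (hz : SimilarityODE α S z) :
    ∃ c, ∀ x ∈ S, y x * deriv z x - deriv y x * z x = c * Real.exp (-x ^ 2) := by
  have hd : ∀ x ∈ S, HasDerivAt
      (fun x => (y x * deriv z x - deriv y x * z x) * Real.exp (x ^ 2)) 0 x := fun x hx =>
    ((((hy.hasDerivAt x hx).mul (hz.hasDerivAt_deriv x hx)).sub
      ((hy.hasDerivAt_deriv x hx).mul (hz.hasDerivAt x hx))).mul
        (hasDerivAt_pow 2 x).exp).congr_deriv (by
          simp only [Pi.mul_apply, Pi.sub_apply]; push_cast; ring)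
  obtain ⟨c, hc⟩ := hS.exists_is_const_of_deriv_eq_zero hS'
    (fun x hx => (hd x hx).differentiableAt.differentiableWithinAt) fun x hx => (hd x hx).deriv
  refine ⟨c, fun x hx => ?_⟩
  rw [← hc x hx, mul_assoc, ← Real.exp_add]
  simp

/-- The factor `e^{-x²}` turns solutions of `w'' = 2 (α + 1) w + 2 x w'` into solutions of the
similarity equation. -/
theorem exp_mul {w w' : ℝ → ℝ} (h1 : ∀ x, HasDerivAt w (w' x) x)
    (h2 : ∀ x, HasDerivAt w' (2 * (α + 1) * w x + 2 * x * w' x) x) :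
    SimilarityODE α univ fun x => Real.exp (-x ^ 2) * w x := by
  have he : ∀ x : ℝ, HasDerivAt (fun x => Real.exp (-x ^ 2)) (-(2 * x) * Real.exp (-x ^ 2)) x :=
    fun x => ((hasDerivAt_pow 2 x).neg.exp).congr_deriv (by simp only [Pi.neg_apply]; push_cast; ring)
  refine of_hasDerivAt (y' := fun x => Real.exp (-x ^ 2) * (w' x - 2 * x * w x))
    (fun x => ((he x).mul (h1 x)).congr_deriv (by ring)) fun x => ?_
  have h3 : HasDerivAt (fun x => w' x - 2 * x * w x)
      (2 * (α + 1) * w x + 2 * x * w' x - (2 * w x + 2 * x * w' x)) x :=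
    (h2 x).sub ((((hasDerivAt_id x).const_mul 2).mul (h1 x)).congr_deriv (by simp))
  exact ((he x).mul h3).congr_deriv (by ring)

end SimilarityODE

section KummerSolutions

variable {σ : ℝ}

theorem hasDerivAt_kummerM_sq (σ a : ℝ) {b : ℝ} (hb : 0 < b) (x : ℝ) :
    HasDerivAt (fun x => kummerM a b (σ * x ^ 2))
      (2 * σ * x * (a / b * kummerM (a + 1) (b + 1) (σ * x ^ 2))) x :=
  ((hasDerivAt_kummerM a hb _).comp x ((hasDerivAt_pow 2 x).const_mul σ)).congr_deriv
    (by push_cast; ring)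

theorem hasDerivAt_kummerM_sq_deriv (hσ : σ ^ 2 = 1) (a : ℝ) {b : ℝ} (hb : 0 < b) (x : ℝ) :
    HasDerivAt (fun x => 2 * σ * x * (a / b * kummerM (a + 1) (b + 1) (σ * x ^ 2)))
      (4 * σ * a * kummerM a b (σ * x ^ 2)
        + (2 * x ^ 2 + (1 - 2 * b) * σ) * (2 * (a / b * kummerM (a + 1) (b + 1) (σ * x ^ 2)))) x := by
  have h := kummerM_ode a hb (σ * x ^ 2)
  refine (((hasDerivAt_id x).const_mul (2 * σ)).mul
    ((hasDerivAt_kummerM_sq σ (a + 1) (b := b + 1) (by positivity) x).const_mul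
      (a / b))).congr_deriv ?_
  simp only [id_eq]
  linear_combination (4 * σ) * h
    + 4 * x ^ 2 * (a / b * kummerM (a + 1) (b + 1) (σ * x ^ 2)) * hσ

theorem hasDerivAt_mul_kummerM_sq (σ a x : ℝ) :
    HasDerivAt (fun x => x * kummerM a (3 / 2) (σ * x ^ 2))
      (kummerM a (3 / 2) (σ * x ^ 2)
        + x * (2 * σ * x * (a / (3 / 2) * kummerM (a + 1) (3 / 2 + 1) (σ * x ^ 2)))) x :=
  ((hasDerivAt_id x).mul (hasDerivAt_kummerM_sq σ a (b := 3 / 2) (by norm_num) x)).congr_deriv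
    (by simp)

theorem hasDerivAt_mul_kummerM_sq_deriv (hσ : σ ^ 2 = 1) (a x : ℝ) :
    HasDerivAt (fun x => kummerM a (3 / 2) (σ * x ^ 2)
        + x * (2 * σ * x * (a / (3 / 2) * kummerM (a + 1) (3 / 2 + 1) (σ * x ^ 2))))
      ((4 * a - 2) * σ * (x * kummerM a (3 / 2) (σ * x ^ 2)) + 2 * σ * x *
        (kummerM a (3 / 2) (σ * x ^ 2)
        + x * (2 * σ * x * (a / (3 / 2) * kummerM (a + 1) (3 / 2 + 1) (σ * x ^ 2))))) x := by
  have hb : (0 : ℝ) < 3 / 2 := by norm_num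
  refine ((hasDerivAt_kummerM_sq σ a hb x).add ((hasDerivAt_id x).mul
    (hasDerivAt_kummerM_sq_deriv hσ a hb x))).congr_deriv ?_
  simp only [id_eq]
  linear_combination
    (-4 * x ^ 3 * (a / (3 / 2) * kummerM (a + 1) (3 / 2 + 1) (σ * x ^ 2))) * hσ

end KummerSolutions

/-- The even solution `M(-α/2, 1/2, -x²)` of the similarity equation. -/
def evenSol (α x : ℝ) : ℝ := kummerM (-α / 2) (1 / 2) (-x ^ 2)

/-- The odd solution `x M(-α/2 + 1/2, 3/2, -x²)` of the similarity equation. -/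
def oddSol (α x : ℝ) : ℝ := x * kummerM (-α / 2 + 1 / 2) (3 / 2) (-x ^ 2)

theorem evenSol_ode (α : ℝ) : SimilarityODE α univ (evenSol α) := by
  have hb : (0 : ℝ) < 1 / 2 := by norm_num
  have hfun : evenSol α = fun x => kummerM (-α / 2) (1 / 2) (-1 * x ^ 2) := by
    funext x
    simp [evenSol]
  rw [hfun]
  exact SimilarityODE.of_hasDerivAt (hasDerivAt_kummerM_sq (-1) (-α / 2) hb) fun x =>
    (hasDerivAt_kummerM_sq_deriv (by norm_num) (-α / 2) hb x).congr_deriv (by ring)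

theorem oddSol_ode (α : ℝ) : SimilarityODE α univ (oddSol α) := by
  have hfun : oddSol α = fun x => x * kummerM (-α / 2 + 1 / 2) (3 / 2) (-1 * x ^ 2) := by
    funext x
    simp [oddSol]
  rw [hfun]
  exact SimilarityODE.of_hasDerivAt (hasDerivAt_mul_kummerM_sq (-1) (-α / 2 + 1 / 2)) fun x =>
    (hasDerivAt_mul_kummerM_sq_deriv (by norm_num) (-α / 2 + 1 / 2) x).congr_deriv (by ring)

theorem evenSol_zero (α : ℝ) : evenSol α 0 = 1 := by simp [evenSol, kummerM_zero]

theorem oddSol_zero (α : ℝ) : oddSol α 0 = 0 := by simp [oddSol]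

theorem deriv_evenSol_zero (α : ℝ) : deriv (evenSol α) 0 = 0 := by
  have h := hasDerivAt_kummerM_sq (-1) (-α / 2) (b := 1 / 2) (by norm_num) 0
  simp only [neg_one_mul, mul_zero, zero_mul] at h
  exact h.deriv

theorem deriv_oddSol_zero (α : ℝ) : deriv (oddSol α) 0 = 1 := by
  have h := hasDerivAt_mul_kummerM_sq (-1) (-α / 2 + 1 / 2) 0
  simp only [neg_one_mul, mul_zero, zero_mul, add_zero, ne_eq, OfNat.ofNat_ne_zero,
    not_false_eq_true, zero_pow, kummerM_zero] at h
  exact h.deriv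

theorem wronskian_evenSol_oddSol (α x : ℝ) :
    evenSol α x * deriv (oddSol α) x - deriv (evenSol α) x * oddSol α x = Real.exp (-x ^ 2) := by
  obtain ⟨c, hc⟩ := (evenSol_ode α).exists_wronskian_eq isOpen_univ isPreconnected_univ
    (oddSol_ode α)
  have h0 := hc 0 trivial
  rw [hc x trivial]
  simp only [evenSol_zero, deriv_oddSol_zero, deriv_evenSol_zero, oddSol_zero] at h0
  norm_num at h0
  rw [← h0, one_mul]

/-- The even and the odd solution span all solutions on an open interval. -/
theorem SimilarityODE.exists_eq_evenSol_oddSol {α : ℝ} {S : Set ℝ} {y : ℝ → ℝ} (hS : IsOpen S)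
    (hS' : IsPreconnected S) (hy : SimilarityODE α S y) :
    ∃ A B, ∀ x ∈ S, y x = A * evenSol α x + B * oddSol α x := by
  obtain ⟨A, hA⟩ := hy.exists_wronskian_eq hS hS' ((oddSol_ode α).mono (subset_univ S))
  obtain ⟨B, hB⟩ := ((evenSol_ode α).mono (subset_univ S)).exists_wronskian_eq hS hS' hy
  refine ⟨A, B, fun x hx => mul_right_cancel₀ (Real.exp_ne_zero (-x ^ 2)) ?_⟩
  linear_combination y x * -wronskian_evenSol_oddSol α x + evenSol α x * hA x hx
    + oddSol α x * hB x hx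

theorem SimilarityODE.eq_evenSol_oddSol {α : ℝ} {y : ℝ → ℝ} (hy : SimilarityODE α univ y) (x : ℝ) :
    y x = y 0 * evenSol α x + deriv y 0 * oddSol α x := by
  obtain ⟨A, B, h⟩ := hy.exists_eq_evenSol_oddSol isOpen_univ isPreconnected_univ
  have hd : deriv y 0 = B := by
    rw [funext fun x => h x trivial,
      ((evenSol_ode α).deriv_linearCombination (oddSol_ode α) A B 0).deriv, deriv_evenSol_zero,
      deriv_oddSol_zero]
    ring
  rw [hd, h x trivial, h 0 trivial, evenSol_zero, oddSol_zero]
  ring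

/-- Kummer's transformation `M(-α/2, 1/2, -x²) = e^{-x²} M(α/2 + 1/2, 1/2, x²)`. -/
theorem evenSol_eq (α x : ℝ) :
    evenSol α x = Real.exp (-x ^ 2) * kummerM (α / 2 + 1 / 2) (1 / 2) (x ^ 2) := by
  have hb : (0 : ℝ) < 1 / 2 := by norm_num
  have h1 := hasDerivAt_kummerM_sq 1 (α / 2 + 1 / 2) hb
  have hode : SimilarityODE α univ
      fun x => Real.exp (-x ^ 2) * kummerM (α / 2 + 1 / 2) (1 / 2) (1 * x ^ 2) :=
    .exp_mul h1 fun x =>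
      (hasDerivAt_kummerM_sq_deriv (by norm_num) (α / 2 + 1 / 2) hb x).congr_deriv (by ring)
  have hd := ((hasDerivAt_pow 2 (0 : ℝ)).neg.exp.mul (h1 0)).deriv
  have h := hode.eq_evenSol_oddSol x
  simp only [Pi.mul_def, Pi.neg_apply] at hd
  rw [hd] at h
  simp [kummerM_zero] at h
  linarith

/-- Kummer's transformation
`x M(-α/2 + 1/2, 3/2, -x²) = e^{-x²} x M(α/2 + 1, 3/2, x²)`. -/
theorem oddSol_eq (α x : ℝ) :
    oddSol α x = Real.exp (-x ^ 2) * (x * kummerM (α / 2 + 1) (3 / 2) (x ^ 2)) := by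
  have h1 := hasDerivAt_mul_kummerM_sq 1 (α / 2 + 1)
  have hode : SimilarityODE α univ
      fun x => Real.exp (-x ^ 2) * (x * kummerM (α / 2 + 1) (3 / 2) (1 * x ^ 2)) :=
    .exp_mul h1 fun x =>
      (hasDerivAt_mul_kummerM_sq_deriv (by norm_num) (α / 2 + 1) x).congr_deriv (by ring)
  have hd := ((hasDerivAt_pow 2 (0 : ℝ)).neg.exp.mul (h1 0)).deriv
  have h := hode.eq_evenSol_oddSol x
  simp only [Pi.mul_def, Pi.neg_apply] at hd
  rw [hd] at h
  simp [kummerM_zero] at h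
  linarith

theorem contDiff_evenSol (α : ℝ) (n : ℕ) : ContDiff ℝ n (evenSol α) :=
  (contDiff_kummerM n (-α / 2) (b := 1 / 2) (by norm_num)).comp (contDiff_id.pow 2).neg

theorem contDiff_oddSol (α : ℝ) (n : ℕ) : ContDiff ℝ n (oddSol α) :=
  contDiff_id.mul ((contDiff_kummerM n (-α / 2 + 1 / 2) (b := 3 / 2) (by norm_num)).comp
    (contDiff_id.pow 2).neg)

/-! ### The integral representation of `U` -/

open MeasureTheory

/-- `∫₀^∞ u^α e^{-u² - 2ux} du`. Up to a positive factor this is the Kummer function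
`U(α/2 + 1/2, 1/2, x²)` for `x ≥ 0`; unlike `U` it also makes sense for `x < 0`. -/
def gaussLaplace (α x : ℝ) : ℝ := ∫ u in Ioi (0 : ℝ), u ^ α * Real.exp (-u ^ 2 - 2 * u * x)

/-- A Gaussian bound on the integrand that is locally uniform in `x`. -/
theorem exp_neg_sq_sub_le {u x R : ℝ} (hx : |x| ≤ R) :
    Real.exp (-u ^ 2 - 2 * u * x) ≤ Real.exp (2 * R ^ 2) * Real.exp (-(1 / 2) * u ^ 2) := by
  rw [← Real.exp_add]
  have hxR : x ^ 2 ≤ R ^ 2 := sq_le_sq' (neg_le_of_abs_le hx) (le_of_abs_le hx)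
  exact Real.exp_le_exp.2 (by nlinarith [sq_nonneg (u + 2 * x)])

theorem measurable_gaussLaplace_integrand (α x : ℝ) :
    Measurable fun u : ℝ => u ^ α * Real.exp (-u ^ 2 - 2 * u * x) := by
  fun_prop

theorem integrableOn_gaussLaplace_bound {α : ℝ} (hα : -1 < α) (R : ℝ) :
    IntegrableOn (fun u : ℝ => u ^ α * (Real.exp (2 * R ^ 2) * Real.exp (-(1 / 2) * u ^ 2)))
      (Ioi 0) := by
  have h := (integrableOn_rpow_mul_exp_neg_mul_sq (b := 1 / 2) (by norm_num) hα).const_mul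
    (Real.exp (2 * R ^ 2))
  refine h.congr (ae_of_all _ fun u => ?_)
  ring

theorem integrableOn_gaussLaplace {α : ℝ} (hα : -1 < α) (x : ℝ) :
    IntegrableOn (fun u : ℝ => u ^ α * Real.exp (-u ^ 2 - 2 * u * x)) (Ioi 0) := by
  refine Integrable.mono' (integrableOn_gaussLaplace_bound hα |x|)
    (measurable_gaussLaplace_integrand α x).aestronglyMeasurable ?_
  refine (ae_restrict_mem measurableSet_Ioi).mono fun u hu => ?_
  have hu' : 0 < u := hu
  rw [Real.norm_of_nonneg (by positivity)]
  gcongr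
  exact exp_neg_sq_sub_le le_rfl

theorem gaussLaplace_pos {α : ℝ} (hα : -1 < α) (x : ℝ) : 0 < gaussLaplace α x := by
  have hpos : ∀ u ∈ Ioi (0 : ℝ), 0 < u ^ α * Real.exp (-u ^ 2 - 2 * u * x) := fun u hu =>
    mul_pos (Real.rpow_pos_of_pos hu α) (Real.exp_pos _)
  unfold gaussLaplace
  rw [setIntegral_pos_iff_support_of_nonneg_ae
    ((ae_restrict_mem measurableSet_Ioi).mono fun u hu => (hpos u hu).le)
    (integrableOn_gaussLaplace hα x)]
  rw [inter_eq_right.2 fun u hu => Function.mem_support.2 (hpos u hu).ne']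
  simp

theorem hasDerivAt_gaussLaplace {α : ℝ} (hα : -1 < α) (x : ℝ) :
    HasDerivAt (gaussLaplace α) (-2 * gaussLaplace (α + 1) x) x := by
  have hmul : ∀ u ∈ Ioi (0 : ℝ), ∀ y : ℝ,
      u ^ α * (Real.exp (-u ^ 2 - 2 * u * y) * (-(2 * u)))
        = -2 * (u ^ (α + 1) * Real.exp (-u ^ 2 - 2 * u * y)) := by
    intro u hu y
    rw [Real.rpow_add_one (ne_of_gt hu)]
    ring
  have h := (hasDerivAt_integral_of_dominated_loc_of_deriv_le
    (μ := volume.restrict (Ioi (0 : ℝ))) (x₀ := x)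
    (F := fun y u => u ^ α * Real.exp (-u ^ 2 - 2 * u * y))
    (F' := fun y u => u ^ α * (Real.exp (-u ^ 2 - 2 * u * y) * (-(2 * u))))
    (bound := fun u => 2 * (u ^ (α + 1) *
      (Real.exp (2 * (|x| + 1) ^ 2) * Real.exp (-(1 / 2) * u ^ 2))))
    (Metric.ball_mem_nhds x one_pos)
    (Eventually.of_forall fun y => (measurable_gaussLaplace_integrand α y).aestronglyMeasurable)
    (integrableOn_gaussLaplace hα x) (Measurable.aestronglyMeasurable (by fun_prop)) ?_
    ((integrableOn_gaussLaplace_bound (by linarith) _).const_mul 2) ?_).2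
  · refine h.congr_deriv ?_
    rw [setIntegral_congr_fun measurableSet_Ioi fun u hu => hmul u hu x, integral_const_mul]
    rfl
  · refine (ae_restrict_mem measurableSet_Ioi).mono fun u hu y hy => ?_
    have hu' : 0 < u := hu
    rw [hmul u hu y, norm_mul, Real.norm_eq_abs (-2), abs_neg, abs_two,
      Real.norm_of_nonneg (by positivity)]
    gcongr
    refine exp_neg_sq_sub_le ?_
    rw [Metric.mem_ball, Real.dist_eq] at hy
    have := abs_add_le x (y - x)
    rw [add_sub_cancel] at this
    linarith
  · refine ae_of_all _ fun u y _ => ?_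
    exact ((((hasDerivAt_id y).const_mul (2 * u)).const_sub (-u ^ 2)).exp.const_mul
      (u ^ α)).congr_deriv (by simp)

theorem strictAnti_gaussLaplace {α : ℝ} (hα : -1 < α) : StrictAnti (gaussLaplace α) := by
  refine strictAnti_of_deriv_neg fun x => ?_
  rw [(hasDerivAt_gaussLaplace hα x).deriv]
  have := gaussLaplace_pos (α := α + 1) (by linarith) x
  linarith

/-- Integration by parts against `u^(α+1)`. -/
theorem gaussLaplace_recurrence {α : ℝ} (hα : -1 < α) (x : ℝ) :
    2 * gaussLaplace (α + 1 + 1) x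
      = (α + 1) * gaussLaplace α x - 2 * x * gaussLaplace (α + 1) x := by
  have hd : ∀ u ∈ Ioi (0 : ℝ), HasDerivAt
      (fun u : ℝ => u ^ (α + 1) * Real.exp (-u ^ 2 - 2 * u * x))
      ((α + 1) * (u ^ α * Real.exp (-u ^ 2 - 2 * u * x))
        - 2 * (u ^ (α + 1 + 1) * Real.exp (-u ^ 2 - 2 * u * x))
        - 2 * x * (u ^ (α + 1) * Real.exp (-u ^ 2 - 2 * u * x))) u := by
    intro u hu
    have h1 : HasDerivAt (fun u : ℝ => -u ^ 2 - 2 * u * x) (-(2 * u) - 2 * x) u :=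
      ((hasDerivAt_pow 2 u).neg.sub (((hasDerivAt_id u).const_mul 2).mul_const x)).congr_deriv
        (by simp)
    refine ((Real.hasDerivAt_rpow_const (p := α + 1) (Or.inl (ne_of_gt hu))).mul
      h1.exp).congr_deriv ?_
    rw [Real.rpow_add_one (ne_of_gt hu) (α + 1), add_sub_cancel_right]
    ring
  have i0 := (integrableOn_gaussLaplace hα x).const_mul (α + 1)
  have i1 := integrableOn_gaussLaplace (α := α + 1) (by linarith) x
  have i2 := (integrableOn_gaussLaplace (α := α + 1 + 1) (by linarith) x).const_mul 2
  have hcont : ContinuousWithinAt (fun u : ℝ => u ^ (α + 1) * Real.exp (-u ^ 2 - 2 * u * x))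
      (Ici 0) 0 := by
    refine ContinuousAt.continuousWithinAt (ContinuousAt.mul ?_ (by fun_prop))
    exact Real.continuousAt_rpow_const _ _ (Or.inr (by linarith))
  have hint := (i0.sub i2).sub (i1.const_mul (2 * x))
  have h := integral_Ioi_of_hasDerivAt_of_tendsto hcont hd hint
    (tendsto_zero_of_hasDerivAt_of_integrableOn_Ioi hd hint i1)
  have e1 := integral_sub (i0.sub i2) (i1.const_mul (2 * x))
  simp only [Pi.sub_apply] at e1
  rw [e1, integral_sub i0 i2, integral_const_mul,
    integral_const_mul, integral_const_mul, Real.zero_rpow (by linarith)] at h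
  simp only [gaussLaplace]
  linarith

theorem gaussLaplace_zero {α : ℝ} (hα : -1 < α) :
    gaussLaplace α 0 = Real.Gamma (α / 2 + 1 / 2) / 2 := by
  have h := integral_rpow_mul_exp_neg_rpow (p := 2) (q := α) (by norm_num) hα
  rw [show (α + 1) / 2 = α / 2 + 1 / 2 by ring] at h
  rw [gaussLaplace, div_eq_mul_one_div, mul_comm, ← h]
  simp

theorem gaussLaplace_ode {α : ℝ} (hα : -1 < α) :
    SimilarityODE α univ fun x => Real.exp (-x ^ 2) * gaussLaplace α x :=
  .exp_mul (hasDerivAt_gaussLaplace hα) fun x =>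
    ((hasDerivAt_gaussLaplace (α := α + 1) (by linarith) x).const_mul (-2)).congr_deriv
      (by linear_combination 2 * gaussLaplace_recurrence hα x)

/-- The integral in terms of the even and odd solutions. -/
theorem exp_mul_gaussLaplace_eq {α : ℝ} (hα : -1 < α) (x : ℝ) :
    Real.exp (-x ^ 2) * gaussLaplace α x
      = Real.Gamma (α / 2 + 1 / 2) / 2 * evenSol α x - Real.Gamma (α / 2 + 1) * oddSol α x := by
  have hd := ((hasDerivAt_pow 2 (0 : ℝ)).neg.exp.mul (hasDerivAt_gaussLaplace hα 0)).deriv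
  have h := (gaussLaplace_ode hα).eq_evenSol_oddSol x
  simp only [Pi.mul_def, Pi.neg_apply] at hd
  rw [hd, gaussLaplace_zero hα, gaussLaplace_zero (by linarith)] at h
  rw [show (α + 1) / 2 + 1 / 2 = α / 2 + 1 by ring] at h
  simp [-one_div] at h
  rw [h]
  ring

theorem evenSol_neg (α x : ℝ) : evenSol α (-x) = evenSol α x := by simp [evenSol]

theorem oddSol_neg (α x : ℝ) : oddSol α (-x) = -oddSol α x := by simp [oddSol]

theorem evenSol_eq_gaussLaplace {α : ℝ} (hα : -1 < α) (x : ℝ) :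
    Real.Gamma (α / 2 + 1 / 2) * evenSol α x
      = Real.exp (-x ^ 2) * (gaussLaplace α (-x) + gaussLaplace α x) := by
  have h1 := exp_mul_gaussLaplace_eq hα x
  have h2 := exp_mul_gaussLaplace_eq hα (-x)
  rw [neg_sq, evenSol_neg, oddSol_neg] at h2
  linear_combination -h1 - h2

theorem oddSol_eq_gaussLaplace {α : ℝ} (hα : -1 < α) (x : ℝ) :
    2 * Real.Gamma (α / 2 + 1) * oddSol α x
      = Real.exp (-x ^ 2) * (gaussLaplace α (-x) - gaussLaplace α x) := by
  have h1 := exp_mul_gaussLaplace_eq hα x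
  have h2 := exp_mul_gaussLaplace_eq hα (-x)
  rw [neg_sq, evenSol_neg, oddSol_neg] at h2
  linear_combination h1 - h2

theorem evenSol_pos {α : ℝ} (hα : -1 < α) (x : ℝ) : 0 < evenSol α x := by
  have hG : 0 < Real.Gamma (α / 2 + 1 / 2) := Real.Gamma_pos_of_pos (by linarith)
  have h1 := gaussLaplace_pos hα x
  have h2 := gaussLaplace_pos hα (-x)
  have h : 0 < Real.Gamma (α / 2 + 1 / 2) * evenSol α x := by
    rw [evenSol_eq_gaussLaplace hα]
    positivity
  exact pos_of_mul_pos_right h hG.le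

theorem oddSol_pos {α : ℝ} (hα : -1 < α) {x : ℝ} (hx : 0 < x) : 0 < oddSol α x := by
  have hG : 0 < Real.Gamma (α / 2 + 1) := Real.Gamma_pos_of_pos (by linarith)
  have h : 0 < 2 * Real.Gamma (α / 2 + 1) * oddSol α x := by
    rw [oddSol_eq_gaussLaplace hα]
    exact mul_pos (Real.exp_pos _)
      (sub_pos.2 (strictAnti_gaussLaplace hα (neg_lt_self hx)))
  exact pos_of_mul_pos_right h (by positivity)

/-- The quotient of the odd by the even solution is strictly increasing, so a nontrivial solution
has at most one zero. -/
theorem oddSol_mul_evenSol_lt {α : ℝ} (hα : -1 < α) {x y : ℝ} (hxy : x < y) :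
    oddSol α x * evenSol α y < oddSol α y * evenSol α x := by
  have hG1 : 0 < Real.Gamma (α / 2 + 1 / 2) := Real.Gamma_pos_of_pos (by linarith)
  have hG2 : 0 < Real.Gamma (α / 2 + 1) := Real.Gamma_pos_of_pos (by linarith)
  have ex := evenSol_eq_gaussLaplace hα x
  have ey := evenSol_eq_gaussLaplace hα y
  have ox := oddSol_eq_gaussLaplace hα x
  have oy := oddSol_eq_gaussLaplace hα y
  have hK : 0 < 2 * Real.Gamma (α / 2 + 1) * Real.Gamma (α / 2 + 1 / 2) := by positivity
  have hprod : gaussLaplace α (-x) * gaussLaplace α y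
      < gaussLaplace α (-y) * gaussLaplace α x :=
    mul_lt_mul'' (strictAnti_gaussLaplace hα (neg_lt_neg hxy)) (strictAnti_gaussLaplace hα hxy)
      (gaussLaplace_pos hα _).le (gaussLaplace_pos hα _).le
  refine lt_of_mul_lt_mul_left ?_ hK.le
  have hE : 0 < Real.exp (-x ^ 2) * Real.exp (-y ^ 2) := by positivity
  have e1 : 2 * Real.Gamma (α / 2 + 1) * Real.Gamma (α / 2 + 1 / 2) *
      (oddSol α y * evenSol α x - oddSol α x * evenSol α y)
      = Real.exp (-x ^ 2) * Real.exp (-y ^ 2) * (2 * (gaussLaplace α (-y) * gaussLaplace α x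
        - gaussLaplace α (-x) * gaussLaplace α y)) := by
    calc _ = (2 * Real.Gamma (α / 2 + 1) * oddSol α y) * (Real.Gamma (α / 2 + 1 / 2) * evenSol α x)
          - (2 * Real.Gamma (α / 2 + 1) * oddSol α x)
            * (Real.Gamma (α / 2 + 1 / 2) * evenSol α y) := by ring
      _ = _ := by rw [ex, ey, ox, oy]; ring
  have e2 := mul_pos hE (mul_pos two_pos (sub_pos.2 hprod))
  rw [← e1] at e2
  linarith

/-- `U(α/2 + 1/2, 1/2, x²)` is a positive multiple of the Laplace integral. -/
theorem kummerU_sq {α x : ℝ} (hα : -1 < α) (hx : 0 ≤ x) :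
    kummerU (α / 2 + 1 / 2) (1 / 2) (x ^ 2) = 2 * √Real.pi * gaussLaplace α x /
      (Real.Gamma (α / 2 + 1 / 2) * Real.Gamma (α / 2 + 1)) := by
  have hG1 : 0 < Real.Gamma (α / 2 + 1 / 2) := Real.Gamma_pos_of_pos (by linarith)
  have hG2 : 0 < Real.Gamma (α / 2 + 1) := Real.Gamma_pos_of_pos (by linarith)
  have hΓ : Real.Gamma (1 / 2 - 1) = -2 * √Real.pi := by
    have h := Real.Gamma_add_one (s := 1 / 2 - 1) (by norm_num)
    rw [sub_add_cancel, Real.Gamma_one_half_eq] at h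
    linarith
  have hs : (x ^ 2) ^ (1 - 1 / 2 : ℝ) = x := by
    rw [show (1 - 1 / 2 : ℝ) = 1 / 2 by norm_num, ← Real.sqrt_eq_rpow, Real.sqrt_sq hx]
  have h := exp_mul_gaussLaplace_eq hα x
  rw [evenSol_eq, oddSol_eq] at h
  have h' : gaussLaplace α x = Real.Gamma (α / 2 + 1 / 2) / 2
      * kummerM (α / 2 + 1 / 2) (1 / 2) (x ^ 2)
      - Real.Gamma (α / 2 + 1) * (x * kummerM (α / 2 + 1) (3 / 2) (x ^ 2)) := by
    refine mul_left_cancel₀ (Real.exp_ne_zero (-x ^ 2)) ?_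
    linear_combination h
  rw [kummerU, hs, hΓ, h', show (1 - 1 / 2 : ℝ) = 1 / 2 by norm_num, Real.Gamma_one_half_eq,
    show α / 2 + 1 / 2 - 1 / 2 + 1 = α / 2 + 1 by ring, show (2 - 1 / 2 : ℝ) = 3 / 2 by norm_num]
  generalize Real.Gamma (α / 2 + 1 / 2) = G₁ at *
  generalize Real.Gamma (α / 2 + 1) = G₂ at *
  generalize kummerM (α / 2 + 1 / 2) (1 / 2) (x ^ 2) = M₁
  generalize kummerM (α / 2 + 1) (3 / 2) (x ^ 2) = M₂
  field_simp
  ring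

/-! ### Growth at infinity -/

/-- The substitution `u = x + v`; the truncation `max · 0` removes `u < 0`, as `0 ^ α = 0`. -/
theorem exp_mul_gaussLaplace_neg_eq {α : ℝ} (hα : 0 < α) {x : ℝ} (hx : 0 < x) :
    Real.exp (-x ^ 2) * gaussLaplace α (-x) / x ^ α
      = ∫ v : ℝ, max (1 + v / x) 0 ^ α * Real.exp (-v ^ 2) := by
  have h1 : ∫ v : ℝ, max (1 + v / x) 0 ^ α * Real.exp (-v ^ 2)
      = ∫ u : ℝ, max (1 + (u - x) / x) 0 ^ α * Real.exp (-(u - x) ^ 2) :=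
    (integral_sub_right_eq_self
      (fun v : ℝ => max (1 + v / x) 0 ^ α * Real.exp (-v ^ 2)) x).symm
  have h2 : ∀ u : ℝ, max (1 + (u - x) / x) 0 ^ α * Real.exp (-(u - x) ^ 2)
      = (Ioi (0 : ℝ)).indicator (fun u => Real.exp (-x ^ 2) / x ^ α
        * (u ^ α * Real.exp (-u ^ 2 - 2 * u * (-x)))) u := by
    intro u
    have h3 : 1 + (u - x) / x = u / x := by rw [sub_div, div_self hx.ne', add_sub_cancel]
    rw [h3]
    by_cases hu : 0 < u
    · rw [indicator_of_mem (mem_Ioi.2 hu), max_eq_left (by positivity),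
        Real.div_rpow hu.le hx.le,
        show -(u - x) ^ 2 = -x ^ 2 + (-u ^ 2 - 2 * u * (-x)) by ring, Real.exp_add]
      ring
    · rw [indicator_of_notMem (by simpa using hu),
        max_eq_right (div_nonpos_of_nonpos_of_nonneg (not_lt.1 hu) hx.le),
        Real.zero_rpow hα.ne', zero_mul]
  rw [h1, integral_congr_ae (ae_of_all _ h2), integral_indicator measurableSet_Ioi,
    integral_const_mul, gaussLaplace]
  ring

/-- The growing solution satisfies `e^{-x²} ∫₀^∞ u^α e^{-u² + 2ux} du ∼ √π x^α`. -/
theorem tendsto_exp_mul_gaussLaplace_neg {α : ℝ} (hα : 0 < α) :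
    Tendsto (fun x => Real.exp (-x ^ 2) * gaussLaplace α (-x) / x ^ α) atTop (𝓝 √Real.pi) := by
  have hlim : ∫ v : ℝ, (1 : ℝ) * Real.exp (-v ^ 2) = √Real.pi := by
    have := integral_gaussian 1
    simpa using this
  rw [← hlim]
  have hT : Tendsto (fun x : ℝ => ∫ v : ℝ, max (1 + v / x) 0 ^ α * Real.exp (-v ^ 2)) atTop
      (𝓝 (∫ v : ℝ, (1 : ℝ) * Real.exp (-v ^ 2))) := by
    refine tendsto_integral_filter_of_dominated_convergence
      (fun v => Real.exp (α ^ 2 / 2) * Real.exp (-(1 / 2) * v ^ 2)) ?_ ?_ ?_ ?_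
    · exact Eventually.of_forall fun x => Measurable.aestronglyMeasurable (by fun_prop)
    -- For `x ≥ 1` the base is at most `e^{|v|}`, and `α |v| ≤ α² / 2 + v² / 2`.
    · filter_upwards [eventually_ge_atTop (1 : ℝ)] with x hx
      refine ae_of_all _ fun v => ?_
      rw [Real.norm_of_nonneg (by positivity), ← Real.exp_add]
      have hv : max (1 + v / x) 0 ≤ Real.exp |v| := by
        refine max_le ?_ (Real.exp_pos _).le
        have h1 : v / x ≤ |v| := (le_abs_self _).trans (by
          rw [abs_div, abs_of_pos (by linarith : 0 < x)]
          exact div_le_self (abs_nonneg v) hx)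
        linarith [Real.add_one_le_exp |v|]
      calc max (1 + v / x) 0 ^ α * Real.exp (-v ^ 2)
          ≤ Real.exp |v| ^ α * Real.exp (-v ^ 2) := by
            gcongr
        _ = Real.exp (|v| * α + -v ^ 2) := by rw [← Real.exp_mul, Real.exp_add]
        _ ≤ _ := by
            refine Real.exp_le_exp.2 ?_
            nlinarith [sq_nonneg (|v| - α), sq_abs v]
    · exact (integrable_exp_neg_mul_sq (by norm_num)).const_mul _
    · refine ae_of_all _ fun v => Tendsto.mul_const _ ?_
      have h1 : Tendsto (fun x : ℝ => max (1 + v / x) 0) atTop (𝓝 (max (1 + 0) 0)) :=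
        (tendsto_const_nhds.add (tendsto_const_nhds.div_atTop tendsto_id)).max
          tendsto_const_nhds
      have h2 := h1.rpow_const (p := α) (Or.inr hα.le)
      simpa using h2
  exact hT.congr' ((eventually_gt_atTop 0).mono fun x hx =>
    (exp_mul_gaussLaplace_neg_eq hα hx).symm)

/-- The decaying solution is negligible at infinity. -/
theorem tendsto_exp_mul_gaussLaplace {α : ℝ} (hα : 0 < α) :
    Tendsto (fun x => Real.exp (-x ^ 2) * gaussLaplace α x / x ^ α) atTop (𝓝 0) := by
  have hz : Tendsto (fun x : ℝ => gaussLaplace α 0 / x ^ α) atTop (𝓝 0) :=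
    tendsto_const_nhds.div_atTop (tendsto_rpow_atTop hα)
  have hα' : -1 < α := by linarith
  refine squeeze_zero' ?_ ?_ hz
  · filter_upwards [eventually_gt_atTop (0 : ℝ)] with x hx
    have := gaussLaplace_pos hα' x
    positivity
  · filter_upwards [eventually_gt_atTop (0 : ℝ)] with x hx
    have h0 := gaussLaplace_pos hα' x
    have h1 := (strictAnti_gaussLaplace hα').antitone hx.le
    have h2 : Real.exp (-x ^ 2) ≤ 1 := Real.exp_le_one_iff.2 (by nlinarith)
    gcongr
    nlinarith

/-- Growth of the general solution of the similarity equation. -/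
theorem tendsto_linearCombination_div_rpow {α : ℝ} (hα : 0 < α) (E F : ℝ) :
    Tendsto (fun x => (E * evenSol α x + F * oddSol α x) / x ^ α) atTop
      (𝓝 ((E / Real.Gamma (α / 2 + 1 / 2) + F / (2 * Real.Gamma (α / 2 + 1))) * √Real.pi)) := by
  have hα' : -1 < α := by linarith
  have hG1 : 0 < Real.Gamma (α / 2 + 1 / 2) := Real.Gamma_pos_of_pos (by linarith)
  have hG2 : 0 < Real.Gamma (α / 2 + 1) := Real.Gamma_pos_of_pos (by linarith)
  have h := ((tendsto_exp_mul_gaussLaplace_neg hα).const_mul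
    (E / Real.Gamma (α / 2 + 1 / 2) + F / (2 * Real.Gamma (α / 2 + 1)))).add
    ((tendsto_exp_mul_gaussLaplace hα).const_mul
    (E / Real.Gamma (α / 2 + 1 / 2) - F / (2 * Real.Gamma (α / 2 + 1))))
  rw [mul_zero, add_zero] at h
  refine h.congr fun x => ?_
  have h1 := evenSol_eq_gaussLaplace hα' x
  have h2 := oddSol_eq_gaussLaplace hα' x
  rw [mul_div_assoc', mul_div_assoc', ← add_div]
  congr 1
  have h1' : evenSol α x = Real.exp (-x ^ 2) * (gaussLaplace α (-x) + gaussLaplace α x)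
      / Real.Gamma (α / 2 + 1 / 2) := by rw [← h1]; field_simp
  have h2' : oddSol α x = Real.exp (-x ^ 2) * (gaussLaplace α (-x) - gaussLaplace α x)
      / (2 * Real.Gamma (α / 2 + 1)) := by rw [← h2]; field_simp
  rw [h1', h2']
  ring

/-! ### The equation for the front coefficient -/

namespace StefanData

variable {p : StefanData}

theorem omega_pos (hdl : 0 < p.dl) (hds : 0 < p.ds) : 0 < p.ω :=
  Real.sqrt_pos.2 (div_pos hdl hds)

theorem f₁_eq (hα : 0 < p.α) (hω : 0 < p.ω) {x : ℝ} (hx : 0 ≤ x) :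
    p.f₁ x = Real.Gamma (p.α / 2 + 1 / 2) * Real.Gamma (p.α / 2 + 1)
      / (2 * √Real.pi * gaussLaplace p.α (x * p.ω)) := by
  rw [f₁, ← mul_pow, kummerU_sq (by linarith) (by positivity), one_div_div]

theorem f₁_zero (hα : 0 < p.α) (hω : 0 < p.ω) :
    p.f₁ 0 = Real.Gamma (p.α / 2 + 1) / √Real.pi := by
  have hG1 : 0 < Real.Gamma (p.α / 2 + 1 / 2) := Real.Gamma_pos_of_pos (by linarith)
  rw [f₁_eq hα hω le_rfl, zero_mul, gaussLaplace_zero (by linarith)]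
  generalize Real.Gamma (p.α / 2 + 1 / 2) = G at *
  field_simp

theorem f₁_strictMonoOn (hα : 0 < p.α) (hω : 0 < p.ω) : StrictMonoOn p.f₁ (Ici 0) := by
  intro x hx y hy hxy
  have hG1 : 0 < Real.Gamma (p.α / 2 + 1 / 2) := Real.Gamma_pos_of_pos (by linarith)
  have hG2 : 0 < Real.Gamma (p.α / 2 + 1) := Real.Gamma_pos_of_pos (by linarith)
  have hα' : -1 < p.α := by linarith
  have h1 := gaussLaplace_pos hα' (y * p.ω)
  have h2 := strictAnti_gaussLaplace hα' (mul_lt_mul_of_pos_right hxy hω)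
  have hpi := Real.sqrt_pos.2 Real.pi_pos
  rw [f₁_eq hα hω hx, f₁_eq hα hω hy]
  gcongr

theorem f₁_pos (hα : 0 < p.α) (hω : 0 < p.ω) {x : ℝ} (hx : 0 ≤ x) : 0 < p.f₁ x := by
  have hG1 : 0 < Real.Gamma (p.α / 2 + 1 / 2) := Real.Gamma_pos_of_pos (by linarith)
  have hG2 : 0 < Real.Gamma (p.α / 2 + 1) := Real.Gamma_pos_of_pos (by linarith)
  have hpi := Real.sqrt_pos.2 Real.pi_pos
  have h1 := gaussLaplace_pos (α := p.α) (by linarith) (x * p.ω)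
  rw [f₁_eq hα hω hx]
  positivity

theorem f₁_continuousOn (hα : 0 < p.α) (hω : 0 < p.ω) : ContinuousOn p.f₁ (Ici 0) := by
  have hα' : -1 < p.α := by linarith
  have hc : Continuous (gaussLaplace p.α) :=
    continuous_iff_continuousAt.2 fun x => (hasDerivAt_gaussLaplace hα' x).continuousAt
  refine ContinuousOn.congr (Continuous.continuousOn ?_) fun x hx => f₁_eq hα hω hx
  refine continuous_const.div (continuous_const.mul (hc.comp (by fun_prop))) fun x => ?_
  have hpi := Real.sqrt_pos.2 Real.pi_pos
  have := gaussLaplace_pos hα' (x * p.ω)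
  exact (by positivity : 0 < 2 * √Real.pi * gaussLaplace p.α (x * p.ω)).ne'

theorem one_le_f₂_denom (hα : 0 < p.α) (hkl : 0 < p.kl) (hh0 : 0 < p.h0) {x : ℝ} (hx : 0 ≤ x) :
    1 ≤ kummerM (p.α / 2 + 1 / 2) (1 / 2) (x ^ 2)
      + 2 * (√p.dl * p.h0 / p.kl) * x * kummerM (p.α / 2 + 1) (3 / 2) (x ^ 2) := by
  have h1 := one_le_kummerM (a := p.α / 2 + 1 / 2) (b := 1 / 2) (z := x ^ 2) (by positivity)
    (by norm_num) (by positivity)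
  have h2 := one_le_kummerM (a := p.α / 2 + 1) (b := 3 / 2) (z := x ^ 2) (by positivity)
    (by norm_num) (by positivity)
  have : 0 ≤ 2 * (√p.dl * p.h0 / p.kl) * x * kummerM (p.α / 2 + 1) (3 / 2) (x ^ 2) := by
    positivity
  linarith

theorem f₂_zero : p.f₂ 0 = 1 := by simp [f₂, kummerM_zero]

theorem f₂_antitoneOn (hα : 0 < p.α) (hkl : 0 < p.kl) (hh0 : 0 < p.h0) :
    AntitoneOn p.f₂ (Ici 0) := by
  intro x hx y hy hxy
  have hx0 : 0 ≤ x := hx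
  have hy0 : 0 ≤ y := hy
  have h0 := one_le_f₂_denom hα hkl hh0 hx0
  have hsq : x ^ 2 ≤ y ^ 2 := by gcongr
  have h1 := kummerM_monotoneOn (a := p.α / 2 + 1 / 2) (b := 1 / 2) (by positivity) (by norm_num)
    (mem_Ici.2 (sq_nonneg x)) (mem_Ici.2 (sq_nonneg y)) hsq
  have h2 := kummerM_monotoneOn (a := p.α / 2 + 1) (b := 3 / 2) (by positivity) (by norm_num)
    (mem_Ici.2 (sq_nonneg x)) (mem_Ici.2 (sq_nonneg y)) hsq
  have h3 := one_le_kummerM (a := p.α / 2 + 1) (b := 3 / 2) (z := x ^ 2) (by positivity)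
    (by norm_num) (by positivity)
  exact one_div_le_one_div_of_le (by linarith) (by gcongr)

theorem f₂_continuousOn (hα : 0 < p.α) (hkl : 0 < p.kl) (hh0 : 0 < p.h0) :
    ContinuousOn p.f₂ (Ici 0) := by
  have hc1 := continuous_kummerM (p.α / 2 + 1 / 2) (b := 1 / 2) (by norm_num)
  have hc2 := continuous_kummerM (p.α / 2 + 1) (b := 3 / 2) (by norm_num)
  refine continuousOn_const.div (Continuous.continuousOn (by fun_prop)) fun x hx => ?_
  have := one_le_f₂_denom hα hkl hh0 hx
  positivity

/-- The difference of the two sides of the front equation decreases strictly from a positive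
value at `0` to `-∞`. -/
theorem exists_unique_frontEquation (hα : 0 < p.α) (hγ : 0 < p.γ) (hkl : 0 < p.kl)
    (hks : 0 < p.ks) (hdl : 0 < p.dl) (hds : 0 < p.ds) (hTi : 0 < p.Ti) (hTinf : 0 < p.Tinf)
    (hh0_pos : 0 < p.h0)
    (hh0 : (2 : ℝ) ^ p.α * Real.Gamma (p.α / 2 + 1) * p.ks * p.Ti * p.ds ^ ((p.α - 1) / 2)
      / (p.Tinf * √Real.pi) < p.h0) :
    ∃ ν : ℝ, 0 < ν ∧ p.FrontEquation ν ∧ ∀ x : ℝ, 0 < x → p.FrontEquation x → x = ν := by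
  have hω := omega_pos hdl hds
  have hpi := Real.sqrt_pos.2 Real.pi_pos
  set C₁ := p.ks * p.Ti * p.ds ^ ((p.α - 1) / 2) / (p.γ * p.dl ^ ((p.α + 1) / 2)) with hC₁
  set C₂ := p.h0 * p.Tinf / (p.γ * (2 : ℝ) ^ p.α * p.dl ^ ((p.α + 1) / 2)) with hC₂
  have hC₁p : 0 < C₁ := by positivity
  have hC₂p : 0 < C₂ := by positivity
  set H : ℝ → ℝ := fun x => -C₁ * p.f₁ x + C₂ * p.f₂ x - x ^ (p.α + 1) with hH
  have hH_iff : ∀ x, p.FrontEquation x ↔ H x = 0 := fun x => by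
    rw [hH, FrontEquation]
    exact sub_eq_zero.symm
  have hanti : StrictAntiOn H (Ici 0) := by
    intro x hx y hy hxy
    have h1 := mul_lt_mul_of_pos_left (f₁_strictMonoOn hα hω hx hy hxy) hC₁p
    have h2 := mul_le_mul_of_nonneg_left (f₂_antitoneOn hα hkl hh0_pos hx hy hxy.le) hC₂p.le
    have h3 : x ^ (p.α + 1) ≤ y ^ (p.α + 1) :=
      Real.rpow_le_rpow hx hxy.le (by linarith)
    simp only [hH]
    linarith
  have hcont : ContinuousOn H (Ici 0) :=
    (((continuousOn_const.mul (f₁_continuousOn hα hω)).add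
      (continuousOn_const.mul (f₂_continuousOn hα hkl hh0_pos)))).sub
      (Real.continuous_rpow_const (by linarith)).continuousOn
  have hH0 : 0 < H 0 := by
    simp only [hH, f₁_zero hα hω, f₂_zero, Real.zero_rpow (by linarith : p.α + 1 ≠ 0)]
    have hD : 0 < p.γ * (2 : ℝ) ^ p.α * p.dl ^ ((p.α + 1) / 2) := by positivity
    have hlt := (div_lt_iff₀ (by positivity)).1 hh0
    have e : C₂ - C₁ * (Real.Gamma (p.α / 2 + 1) / √Real.pi)
        = (p.h0 * (p.Tinf * √Real.pi) - (2 : ℝ) ^ p.α * Real.Gamma (p.α / 2 + 1) * p.ks * p.Ti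
          * p.ds ^ ((p.α - 1) / 2))
          / (p.γ * (2 : ℝ) ^ p.α * p.dl ^ ((p.α + 1) / 2) * √Real.pi) := by
      rw [hC₁, hC₂]
      generalize Real.Gamma (p.α / 2 + 1) = G
      generalize p.ds ^ ((p.α - 1) / 2) = D at *
      have : 0 < p.dl ^ ((p.α + 1) / 2) := by positivity
      generalize p.dl ^ ((p.α + 1) / 2) = D' at *
      field_simp
    have : 0 < C₂ - C₁ * (Real.Gamma (p.α / 2 + 1) / √Real.pi) := by
      rw [e]
      exact div_pos (sub_pos.2 hlt) (by positivity)
    linarith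
  -- As `f₁ ≥ 0` and `f₂ ≤ 1`, the left side stays below `C₂`, while `x^(α+1) ≥ x` for `x ≥ 1`.
  have hX : H (C₂ + 1) < 0 := by
    have hX0 : 0 ≤ C₂ + 1 := by linarith
    have h1 := mul_pos hC₁p (f₁_pos hα hω hX0)
    have h2 := mul_le_mul_of_nonneg_left
      (f₂_antitoneOn hα hkl hh0_pos (mem_Ici.2 le_rfl) (mem_Ici.2 hX0) hX0) hC₂p.le
    rw [f₂_zero] at h2
    have h3 : (C₂ + 1) ^ (1 : ℝ) ≤ (C₂ + 1) ^ (p.α + 1) :=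
      Real.rpow_le_rpow_of_exponent_le (by linarith) (by linarith)
    rw [Real.rpow_one] at h3
    simp only [hH]
    linarith
  obtain ⟨ν, hν, hν0⟩ := intermediate_value_Ioo' (by linarith : (0 : ℝ) ≤ C₂ + 1)
    (hcont.mono Icc_subset_Ici_self) ⟨hX, hH0⟩
  refine ⟨ν, hν.1, (hH_iff ν).2 hν0, fun x hx hxe => ?_⟩
  exact hanti.injOn (mem_Ici.2 hx.le) (mem_Ici.2 hν.1.le) (((hH_iff x).1 hxe).trans hν0.symm)

end StefanData

/-! ### Self-similar temperatures -/

/-- The general solution `E · evenSol + F · oddSol` of the similarity equation. -/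
def profile (α E F η : ℝ) : ℝ := E * evenSol α η + F * oddSol α η

theorem profile_ode (α E F : ℝ) : SimilarityODE α univ (profile α E F) :=
  (evenSol_ode α).linearCombination (oddSol_ode α) E F

theorem deriv_profile (α E F η : ℝ) :
    deriv (profile α E F) η = E * deriv (evenSol α) η + F * deriv (oddSol α) η :=
  ((evenSol_ode α).deriv_linearCombination (oddSol_ode α) E F η).deriv

theorem contDiff_profile (α E F : ℝ) (n : ℕ) : ContDiff ℝ n (profile α E F) :=
  (contDiff_const.mul (contDiff_evenSol α n)).add (contDiff_const.mul (contDiff_oddSol α n))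

theorem continuous_profile (α E F : ℝ) : Continuous (profile α E F) :=
  (contDiff_profile α E F 0).continuous

theorem profile_zero (α E F : ℝ) : profile α E F 0 = E := by
  simp [profile, evenSol_zero, oddSol_zero]

theorem deriv_profile_zero (α E F : ℝ) : deriv (profile α E F) 0 = F := by
  simp [deriv_profile, deriv_evenSol_zero, deriv_oddSol_zero]

/-- The slope of a solution at one of its zeros, from the Wronskian. -/
theorem deriv_profile_of_zero {α E F η : ℝ} (hα : -1 < α) (h : profile α E F η = 0) :
    deriv (profile α E F) η = F / kummerM (α / 2 + 1 / 2) (1 / 2) (η ^ 2) := by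
  have hM : 0 < kummerM (α / 2 + 1 / 2) (1 / 2) (η ^ 2) :=
    zero_lt_one.trans_le (one_le_kummerM (by linarith) (by norm_num) (sq_nonneg η))
  have hw := wronskian_evenSol_oddSol α η
  have he := evenSol_pos hα η
  rw [profile] at h
  rw [deriv_profile, eq_div_iff hM.ne']
  refine mul_left_cancel₀ (Real.exp_ne_zero (-η ^ 2)) ?_
  have hM' := evenSol_eq α η
  linear_combination F * hw + deriv (evenSol α) η * h
    - (E * deriv (evenSol α) η + F * deriv (oddSol α) η) * hM'

/-- A solution of the similarity equation on an open interval that is continuous up to the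
boundary is a combination of the even and odd solutions up to the boundary. -/
theorem SimilarityODE.exists_eqOn_profile {α : ℝ} {S T : Set ℝ} {f : ℝ → ℝ} (hS : IsOpen S)
    (hS' : IsPreconnected S) (hST : S ⊆ T) (hT : T ⊆ closure S) (hf : SimilarityODE α S f)
    (hc : ContinuousOn f T) : ∃ E F, EqOn f (profile α E F) T := by
  obtain ⟨E, F, h⟩ := hf.exists_eq_evenSol_oddSol hS hS'
  exact ⟨E, F, EqOn.of_subset_closure (fun x hx => h x hx) hc
    (continuous_profile α E F).continuousOn hST hT⟩

section Similarity

variable {α d t x : ℝ}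

theorem similarityScale_pos (hd : 0 < d) (ht : 0 < t) : 0 < 2 * √(d * t) := by positivity

theorem hasDerivAt_similarity_space {f : ℝ → ℝ} {f' : ℝ}
    (hf : HasDerivAt f f' (x / (2 * √(d * t)))) :
    HasDerivAt (fun y => t ^ (α / 2) * f (y / (2 * √(d * t))))
      (t ^ (α / 2) * (f' / (2 * √(d * t)))) x :=
  ((hf.comp x ((hasDerivAt_id x).div_const _)).const_mul _).congr_deriv (by ring)

theorem iteratedDeriv_similarity_space (f : ℝ → ℝ) :
    iteratedDeriv 2 (fun y => t ^ (α / 2) * f (y / (2 * √(d * t)))) x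
      = t ^ (α / 2) * (deriv (deriv f) (x / (2 * √(d * t))) / (2 * √(d * t)) ^ 2) := by
  have h : ∀ (K c : ℝ) (g : ℝ → ℝ),
      deriv (fun y => K * g (y / c)) = fun y => (K / c) * deriv g (y / c) := by
    intro K c g
    funext y
    have h1 := deriv_comp_mul_left c⁻¹ g y
    simp only [smul_eq_mul] at h1
    rw [deriv_const_mul_field]
    simp only [div_eq_inv_mul] at h1 ⊢
    rw [h1]
    ring
  rw [iteratedDeriv_succ, iteratedDeriv_one, h, h]
  ring

theorem hasDerivAt_similarity_time (hd : 0 < d) (ht : 0 < t) {f : ℝ → ℝ} {f' : ℝ}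
    (hf : HasDerivAt f f' (x / (2 * √(d * t)))) :
    HasDerivAt (fun τ => τ ^ (α / 2) * f (x / (2 * √(d * τ))))
      (t ^ (α / 2) / t * (α / 2 * f (x / (2 * √(d * t)))
        - x / (2 * √(d * t)) / 2 * f')) t := by
  have hdt : 0 < d * t := mul_pos hd ht
  have hs : 0 < √(d * t) := Real.sqrt_pos.2 hdt
  have h1 : HasDerivAt (fun τ => 2 * √(d * τ)) (2 * (d / (2 * √(d * t)))) t :=
    ((((hasDerivAt_id t).const_mul d).sqrt hdt.ne').const_mul 2).congr_deriv (by simp)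
  have h2 : HasDerivAt (fun τ => x / (2 * √(d * τ))) (-(x / (2 * √(d * t)) / (2 * t))) t := by
    refine ((hasDerivAt_const t x).div h1 (by positivity)).congr_deriv ?_
    have hsq := Real.sq_sqrt hdt.le
    field_simp
    rw [hsq]
    ring
  have h3 := (Real.hasDerivAt_rpow_const (x := t) (p := α / 2) (Or.inl ht.ne')).mul
    (HasDerivAt.comp t hf h2)
  refine h3.congr_deriv ?_
  rw [Real.rpow_sub_one ht.ne']
  simp only [Function.comp_apply]
  field_simp
  ring

/-- For self-similar functions the heat equation is the similarity equation of the profile. -/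
theorem heat_iff_similarity (hd : 0 < d) (ht : 0 < t) {f : ℝ → ℝ}
    (hf : DifferentiableAt ℝ f (x / (2 * √(d * t)))) :
    deriv (fun τ => τ ^ (α / 2) * f (x / (2 * √(d * τ)))) t
        = d * iteratedDeriv 2 (fun y => t ^ (α / 2) * f (y / (2 * √(d * t)))) x ↔
      deriv (deriv f) (x / (2 * √(d * t))) = 2 * α * f (x / (2 * √(d * t)))
        - 2 * (x / (2 * √(d * t))) * deriv f (x / (2 * √(d * t))) := by
  rw [(hasDerivAt_similarity_time hd ht hf.hasDerivAt).deriv, iteratedDeriv_similarity_space,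
    mul_pow, Real.sq_sqrt (by positivity)]
  have hK : 0 < t ^ (α / 2) := Real.rpow_pos_of_pos ht _
  generalize x / (2 * √(d * t)) = η
  have e : d * (t ^ (α / 2) * (deriv (deriv f) η / (2 ^ 2 * (d * t))))
      = t ^ (α / 2) / t * (deriv (deriv f) η / 4) := by
    field_simp
    ring
  rw [e, mul_right_inj' (by positivity)]
  constructor <;> intro h <;> linarith

/-- The profile of a self-similar classical solution of the heat equation solves the similarity
equation. -/
theorem similarity_profile_ode (hd : 0 < d) (ht : 0 < t) {Ψ : ℝ → ℝ → ℝ} {f : ℝ → ℝ}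
    (hspace : ∀ᶠ y in 𝓝 x, Ψ y t = t ^ (α / 2) * f (y / (2 * √(d * t))))
    (htime : ∀ᶠ τ in 𝓝 t, Ψ x τ = τ ^ (α / 2) * f (x / (2 * √(d * τ))))
    (hreg : ContDiffAt ℝ 2 (fun y => Ψ y t) x)
    (hheat : deriv (fun τ => Ψ x τ) t = d * iteratedDeriv 2 (fun y => Ψ y t) x) :
    HasDerivAt f (deriv f (x / (2 * √(d * t)))) (x / (2 * √(d * t))) ∧
      HasDerivAt (deriv f) (2 * α * f (x / (2 * √(d * t)))
        - 2 * (x / (2 * √(d * t))) * deriv f (x / (2 * √(d * t)))) (x / (2 * √(d * t))) := by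
  have hc := similarityScale_pos hd ht
  have hK : 0 < t ^ (α / 2) := Real.rpow_pos_of_pos ht _
  have hx : 2 * √(d * t) * (x / (2 * √(d * t))) = x := by field_simp
  have hreg' : ContDiffAt ℝ 2 f (x / (2 * √(d * t))) := by
    have h1 : ContDiffAt ℝ 2 (fun ξ => (t ^ (α / 2))⁻¹ * Ψ (2 * √(d * t) * ξ) t)
        (x / (2 * √(d * t))) := by
      refine contDiffAt_const.mul (ContDiffAt.comp (x / (2 * √(d * t)))
        (g := fun y => Ψ y t) (f := fun ξ => 2 * √(d * t) * ξ) ?_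
        (contDiffAt_const.mul contDiffAt_id))
      rwa [hx]
    refine h1.congr_of_eventuallyEq ?_
    have hcont : Tendsto (fun ξ => 2 * √(d * t) * ξ) (𝓝 (x / (2 * √(d * t)))) (𝓝 x) := by
      have : ContinuousAt (fun ξ => 2 * √(d * t) * ξ) (x / (2 * √(d * t))) := by fun_prop
      rwa [ContinuousAt, hx] at this
    filter_upwards [hcont.eventually hspace] with ξ hξ
    rw [hξ, mul_div_cancel_left₀ _ hc.ne', inv_mul_cancel_left₀ hK.ne']
  have hdiff : DifferentiableAt ℝ f (x / (2 * √(d * t))) :=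
    hreg'.differentiableAt (by norm_num)
  have hdiff' : DifferentiableAt ℝ (deriv f) (x / (2 * √(d * t))) := by
    have h1 : ContDiffAt ℝ 1 (fderiv ℝ f) (x / (2 * √(d * t))) :=
      hreg'.fderiv_right (by norm_num)
    exact (h1.differentiableAt (by norm_num)).clm_apply (differentiableAt_const (1 : ℝ))
  rw [EventuallyEq.deriv_eq htime, EventuallyEq.iteratedDeriv_eq 2 hspace,
    heat_iff_similarity hd ht hdiff] at hheat
  exact ⟨hdiff.hasDerivAt, hheat ▸ hdiff'.hasDerivAt⟩

end Similarity

namespace StefanData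

theorem kummerTemperature_eq (α d E F x t : ℝ) :
    kummerTemperature α d E F x t = t ^ (α / 2) * profile α E F (x / (2 * √(d * t))) := by
  rw [kummerTemperature, profile, evenSol, oddSol]
  ring

theorem contDiff_kummerTemperature (α d E F t : ℝ) :
    ContDiff ℝ 2 fun y => kummerTemperature α d E F y t := by
  simp only [kummerTemperature_eq]
  exact contDiff_const.mul ((contDiff_profile α E F 2).comp (contDiff_id.div_const _))

theorem hasDerivAt_kummerTemperature (α d E F x t : ℝ) :
    HasDerivAt (fun y => kummerTemperature α d E F y t)
      (t ^ (α / 2) * (deriv (profile α E F) (x / (2 * √(d * t))) / (2 * √(d * t)))) x := by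
  simp only [kummerTemperature_eq]
  exact hasDerivAt_similarity_space ((profile_ode α E F).hasDerivAt _ trivial)

theorem differentiableAt_kummerTemperature_time (α : ℝ) {d t : ℝ} (hd : 0 < d) (ht : 0 < t)
    (E F x : ℝ) : DifferentiableAt ℝ (fun τ => kummerTemperature α d E F x τ) t := by
  simp only [kummerTemperature_eq]
  exact (hasDerivAt_similarity_time hd ht
    ((profile_ode α E F).hasDerivAt _ trivial)).differentiableAt

theorem kummerTemperature_heat (α : ℝ) {d t : ℝ} (hd : 0 < d) (ht : 0 < t) (E F x : ℝ) :
    deriv (fun τ => kummerTemperature α d E F x τ) t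
      = d * iteratedDeriv 2 (fun y => kummerTemperature α d E F y t) x := by
  simp only [kummerTemperature_eq]
  exact (heat_iff_similarity hd ht
    ((profile_ode α E F).hasDerivAt _ trivial).differentiableAt).2
    ((profile_ode α E F).hasDerivAt_deriv _ trivial).deriv

/-- The initial values of a self-similar temperature are given by the growth of its profile at
infinity. -/
theorem tendsto_kummerTemperature {α d x : ℝ} (hα : 0 < α) (hd : 0 < d) (hx : 0 < x) (E F : ℝ) :
    Tendsto (fun t => kummerTemperature α d E F x t) (𝓝[>] 0)
      (𝓝 ((x / (2 * √d)) ^ α * ((E / Real.Gamma (α / 2 + 1 / 2)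
        + F / (2 * Real.Gamma (α / 2 + 1))) * √Real.pi))) := by
  have hη : Tendsto (fun t : ℝ => x / (2 * √(d * t))) (𝓝[>] 0) atTop := by
    have h0 : Tendsto (fun t : ℝ => 2 * √(d * t)) (𝓝[>] 0) (𝓝[>] 0) := by
      refine tendsto_nhdsWithin_iff.2 ⟨?_, ?_⟩
      · have : ContinuousAt (fun t : ℝ => 2 * √(d * t)) 0 := by fun_prop
        have h := this.tendsto
        simp only [mul_zero, Real.sqrt_zero] at h
        exact h.mono_left nhdsWithin_le_nhds
      · filter_upwards [self_mem_nhdsWithin] with t ht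
        exact similarityScale_pos hd ht
    simp only [div_eq_mul_inv]
    exact (h0.inv_tendsto_nhdsGT_zero).const_mul_atTop hx
  have h := ((tendsto_linearCombination_div_rpow hα E F).comp hη).const_mul ((x / (2 * √d)) ^ α)
  refine h.congr' ?_
  filter_upwards [self_mem_nhdsWithin] with t ht
  have ht' : 0 < t := ht
  rw [kummerTemperature_eq]
  have e : (x / (2 * √(d * t))) ^ α = (x / (2 * √d)) ^ α / t ^ (α / 2) := by
    rw [Real.sqrt_mul hd.le, ← mul_assoc, ← div_div, Real.div_rpow (by positivity) (by positivity),
      Real.sqrt_eq_rpow t, ← Real.rpow_mul ht'.le]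
    congr 2
    ring
  have hA : 0 < (x / (2 * √d)) ^ α := by positivity
  have hB : 0 < t ^ (α / 2) := by positivity
  simp only [Function.comp_apply]
  rw [e, profile]
  field_simp

end StefanData

/-! ### The coefficients determined by the boundary conditions -/

namespace StefanData

variable {p : StefanData}

theorem liquid_denom_pos (hα : 0 < p.α) (hkl : 0 < p.kl) (hh0 : 0 < p.h0) {ν : ℝ} (hν : 0 < ν) :
    0 < p.kl * evenSol p.α ν + 2 * √p.dl * p.h0 * oddSol p.α ν := by
  have h1 := evenSol_pos (α := p.α) (by linarith) ν
  have h2 := oddSol_pos (α := p.α) (by linarith) hν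
  positivity

theorem Fl_eq (ν : ℝ) : p.Fl ν = -(2 * √p.dl * p.h0 * p.Tinf * evenSol p.α ν) /
    (p.kl * evenSol p.α ν + 2 * √p.dl * p.h0 * oddSol p.α ν) := by
  rw [Fl, evenSol, oddSol]
  ring

theorem El_eq (ν : ℝ) : p.El ν = -(oddSol p.α ν / evenSol p.α ν * p.Fl ν) := by
  rw [El, evenSol, oddSol]
  ring

/-- The front and the convective condition fix the coefficients of the liquid profile. -/
theorem liquid_conditions_iff (hα : 0 < p.α) (hkl : 0 < p.kl) (hdl : 0 < p.dl) (hh0 : 0 < p.h0)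
    {ν t : ℝ} (hν : 0 < ν) (ht : 0 < t) (E F : ℝ) :
    (profile p.α E F ν = 0 ∧
      p.kl * (t ^ (p.α / 2) * (F / (2 * √(p.dl * t))))
        = p.h0 * t ^ (-(1 / 2) : ℝ) * (t ^ (p.α / 2) * E - p.Tinf * t ^ (p.α / 2)))
      ↔ E = p.El ν ∧ F = p.Fl ν := by
  have he := evenSol_pos (α := p.α) (by linarith) ν
  have hD := liquid_denom_pos hα hkl hh0 hν (p := p)
  have hs : 0 < √p.dl := Real.sqrt_pos.2 hdl
  have hst : 0 < √t := Real.sqrt_pos.2 ht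
  have hK : 0 < t ^ (p.α / 2) := by positivity
  have hc : p.kl * (t ^ (p.α / 2) * (F / (2 * √(p.dl * t))))
        = p.h0 * t ^ (-(1 / 2) : ℝ) * (t ^ (p.α / 2) * E - p.Tinf * t ^ (p.α / 2))
      ↔ p.kl * F = 2 * √p.dl * p.h0 * (E - p.Tinf) := by
    rw [Real.rpow_neg ht.le, ← Real.sqrt_eq_rpow, Real.sqrt_mul hdl.le]
    generalize t ^ (p.α / 2) = K at *
    have e1 : p.kl * (K * (F / (2 * (√p.dl * √t)))) = K / (2 * √p.dl * √t) * (p.kl * F) := by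
      field_simp
    have e2 : p.h0 * (√t)⁻¹ * (K * E - p.Tinf * K)
        = K / (2 * √p.dl * √t) * (2 * √p.dl * p.h0 * (E - p.Tinf)) := by
      field_simp
    rw [e1, e2, mul_right_inj' (by positivity)]
  rw [hc, profile, El_eq, Fl_eq]
  constructor
  · rintro ⟨h1, h2⟩
    have hE : E = -(oddSol p.α ν / evenSol p.α ν * F) := by
      field_simp
      linarith
    have hF : F = -(2 * √p.dl * p.h0 * p.Tinf * evenSol p.α ν) /
        (p.kl * evenSol p.α ν + 2 * √p.dl * p.h0 * oddSol p.α ν) := by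
      rw [eq_div_iff hD.ne']
      linear_combination evenSol p.α ν * h2 + 2 * √p.dl * p.h0 * h1
    exact ⟨by rw [← hF]; exact hE, hF⟩
  · rintro ⟨h1, h2⟩
    rw [← h2] at h1
    have h2' := (eq_div_iff hD.ne').1 h2
    have h1' : E * evenSol p.α ν + F * oddSol p.α ν = 0 := by
      rw [h1]
      field_simp
      ring
    refine ⟨h1', mul_left_cancel₀ he.ne' ?_⟩
    linear_combination h2' - 2 * √p.dl * p.h0 * h1'

theorem Fl_neg (hα : 0 < p.α) (hkl : 0 < p.kl) (hdl : 0 < p.dl) (hTinf : 0 < p.Tinf)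
    (hh0 : 0 < p.h0) {ν : ℝ} (hν : 0 < ν) : p.Fl ν < 0 := by
  have he := evenSol_pos (α := p.α) (by linarith) ν
  have hs : 0 < √p.dl := Real.sqrt_pos.2 hdl
  rw [Fl_eq]
  exact div_neg_of_neg_of_pos (neg_neg_of_pos (by positivity)) (liquid_denom_pos hα hkl hh0 hν)

theorem Fl_div_kummerM (hα : 0 < p.α) (hkl : 0 < p.kl) (ν : ℝ) :
    p.Fl ν / kummerM (p.α / 2 + 1 / 2) (1 / 2) (ν ^ 2)
      = -(2 * √p.dl * p.h0 * p.Tinf / p.kl * p.f₂ ν) := by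
  have hM : 0 < kummerM (p.α / 2 + 1 / 2) (1 / 2) (ν ^ 2) :=
    zero_lt_one.trans_le (one_le_kummerM (by linarith) (by norm_num) (sq_nonneg ν))
  have hexp := Real.exp_pos (-ν ^ 2)
  rw [Fl_eq, f₂, evenSol_eq, oddSol_eq]
  generalize kummerM (p.α / 2 + 1 / 2) (1 / 2) (ν ^ 2) = M at *
  generalize kummerM (p.α / 2 + 1) (3 / 2) (ν ^ 2) = N
  generalize Real.exp (-ν ^ 2) = e at *
  have h1 : p.kl * (e * M) + 2 * √p.dl * p.h0 * (e * (ν * N))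
      = e * (p.kl * (M + 2 * (√p.dl * p.h0 / p.kl) * ν * N)) := by
    field_simp
  rw [h1]
  generalize M + 2 * (√p.dl * p.h0 / p.kl) * ν * N = D
  field_simp

theorem Fs_eq (ν : ℝ) : p.Fs ν = -(p.Ti * (2 : ℝ) ^ (p.α + 1) * p.ds ^ (p.α / 2)
    * kummerM (p.α / 2 + 1 / 2) (1 / 2) ((ν * p.ω) ^ 2) * p.f₁ ν) := by
  rw [Fs, f₁, mul_pow]
  ring

theorem Es_eq (ν : ℝ) :
    p.Es ν = -(oddSol p.α (ν * p.ω) / evenSol p.α (ν * p.ω) * p.Fs ν) := by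
  rw [Es, evenSol, oddSol, mul_pow]
  ring

theorem Fs_div_kummerM (hα : 0 < p.α) (ν : ℝ) :
    p.Fs ν / kummerM (p.α / 2 + 1 / 2) (1 / 2) ((ν * p.ω) ^ 2)
      = -(p.Ti * (2 : ℝ) ^ (p.α + 1) * p.ds ^ (p.α / 2) * p.f₁ ν) := by
  have hM : 0 < kummerM (p.α / 2 + 1 / 2) (1 / 2) ((ν * p.ω) ^ 2) :=
    zero_lt_one.trans_le (one_le_kummerM (by linarith) (by norm_num) (sq_nonneg _))
  rw [Fs_eq, div_eq_iff hM.ne']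
  ring

/-- For a profile vanishing at `νω`, the coefficient of its growth at infinity is `F U / (2 M)`. -/
theorem growth_of_profile_zero (hα : 0 < p.α) (hω : 0 < p.ω) {ν E F : ℝ} (hν : 0 < ν)
    (h : profile p.α E F (ν * p.ω) = 0) :
    (E / Real.Gamma (p.α / 2 + 1 / 2) + F / (2 * Real.Gamma (p.α / 2 + 1))) * √Real.pi
      = F / (2 * kummerM (p.α / 2 + 1 / 2) (1 / 2) ((ν * p.ω) ^ 2) * p.f₁ ν) := by
  have hα' : -1 < p.α := by linarith
  have hG1 : 0 < Real.Gamma (p.α / 2 + 1 / 2) := Real.Gamma_pos_of_pos (by linarith)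
  have hG2 : 0 < Real.Gamma (p.α / 2 + 1) := Real.Gamma_pos_of_pos (by linarith)
  have hM : 0 < kummerM (p.α / 2 + 1 / 2) (1 / 2) ((ν * p.ω) ^ 2) :=
    zero_lt_one.trans_le (one_le_kummerM (by linarith) (by norm_num) (sq_nonneg _))
  have hg := exp_mul_gaussLaplace_eq hα' (ν * p.ω)
  have he := evenSol_eq p.α (ν * p.ω)
  have hpos := gaussLaplace_pos hα' (ν * p.ω)
  have hpi := Real.sqrt_pos.2 Real.pi_pos
  have hexp := Real.exp_pos (-(ν * p.ω) ^ 2)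
  rw [f₁_eq hα hω hν.le]
  rw [profile] at h
  rw [he] at h hg
  generalize Real.exp (-(ν * p.ω) ^ 2) = e at *
  generalize Real.Gamma (p.α / 2 + 1 / 2) = G₁ at *
  generalize Real.Gamma (p.α / 2 + 1) = G₂ at *
  generalize kummerM (p.α / 2 + 1 / 2) (1 / 2) ((ν * p.ω) ^ 2) = M at *
  generalize gaussLaplace p.α (ν * p.ω) = L at *
  generalize √Real.pi = P at *
  have key : M * (2 * E * G₂ + F * G₁) = 2 * F * L := by
    refine mul_left_cancel₀ hexp.ne' ?_
    linear_combination 2 * G₂ * h - 2 * F * hg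
  have h1 : (E / G₁ + F / (2 * G₂)) * P = (M * (2 * E * G₂ + F * G₁)) * P / (2 * M * G₁ * G₂) := by
    field_simp
  rw [h1, key]
  field_simp

/-- The front condition and the initial condition fix the coefficients of the solid profile. -/
theorem solid_conditions_iff (hα : 0 < p.α) (hω : 0 < p.ω) (hds : 0 < p.ds) {ν : ℝ} (hν : 0 < ν)
    (E F : ℝ) :
    (profile p.α E F (ν * p.ω) = 0 ∧
      (E / Real.Gamma (p.α / 2 + 1 / 2) + F / (2 * Real.Gamma (p.α / 2 + 1))) * √Real.pi
        = -p.Ti * (2 * √p.ds) ^ p.α)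
      ↔ E = p.Es ν ∧ F = p.Fs ν := by
  have he := evenSol_pos (α := p.α) (by linarith) (ν * p.ω)
  have hM : 0 < kummerM (p.α / 2 + 1 / 2) (1 / 2) ((ν * p.ω) ^ 2) :=
    zero_lt_one.trans_le (one_le_kummerM (by linarith) (by norm_num) (sq_nonneg _))
  have hf := f₁_pos hα hω hν.le (p := p)
  have hpow : (2 * √p.ds) ^ p.α = (2 : ℝ) ^ (p.α + 1) * p.ds ^ (p.α / 2) / 2 := by
    rw [Real.mul_rpow zero_le_two (Real.sqrt_nonneg _), Real.rpow_add_one two_ne_zero,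
      Real.sqrt_eq_rpow, ← Real.rpow_mul hds.le, show 1 / 2 * p.α = p.α / 2 by ring]
    ring
  have hzero : profile p.α E F (ν * p.ω) = 0
      ↔ E = -(oddSol p.α (ν * p.ω) / evenSol p.α (ν * p.ω) * F) := by
    rw [profile]
    field_simp
    constructor <;> intro h <;> linarith
  have hgrow : profile p.α E F (ν * p.ω) = 0 →
      ((E / Real.Gamma (p.α / 2 + 1 / 2) + F / (2 * Real.Gamma (p.α / 2 + 1))) * √Real.pi
        = -p.Ti * (2 * √p.ds) ^ p.α ↔ F = p.Fs ν) := by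
    intro h
    rw [growth_of_profile_zero hα hω hν h, div_eq_iff (by positivity), hpow, Fs_eq]
    have e : -p.Ti * ((2 : ℝ) ^ (p.α + 1) * p.ds ^ (p.α / 2) / 2)
        * (2 * kummerM (p.α / 2 + 1 / 2) (1 / 2) ((ν * p.ω) ^ 2) * p.f₁ ν)
        = -(p.Ti * (2 : ℝ) ^ (p.α + 1) * p.ds ^ (p.α / 2)
          * kummerM (p.α / 2 + 1 / 2) (1 / 2) ((ν * p.ω) ^ 2) * p.f₁ ν) := by ring
    rw [e]
  constructor
  · rintro ⟨h1, h2⟩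
    have hF := (hgrow h1).1 h2
    refine ⟨?_, hF⟩
    rw [Es_eq, ← hF]
    exact hzero.1 h1
  · rintro ⟨h1, h2⟩
    rw [Es_eq, ← h2] at h1
    exact ⟨hzero.2 h1, (hgrow (hzero.2 h1)).2 h2⟩

theorem front_div_scale (hdl : 0 < p.dl) {ν t : ℝ} (ht : 0 < t) :
    p.front ν t / (2 * √(p.dl * t)) = ν := by
  have := similarityScale_pos hdl ht
  rw [front]
  field_simp

theorem front_div_scale_solid (hdl : 0 < p.dl) (hds : 0 < p.ds) {ν t : ℝ} (ht : 0 < t) :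
    p.front ν t / (2 * √(p.ds * t)) = ν * p.ω := by
  have h1 : 0 < √p.ds := Real.sqrt_pos.2 hds
  have h2 : 0 < √t := Real.sqrt_pos.2 ht
  rw [front, ω, Real.sqrt_div hdl.le, Real.sqrt_mul hdl.le, Real.sqrt_mul hds.le]
  field_simp

theorem hasDerivAt_front (hdl : 0 < p.dl) (ν : ℝ) {t : ℝ} (ht : 0 < t) :
    HasDerivAt (p.front ν) (ν * √p.dl / √t) t := by
  have h : HasDerivAt (fun τ => 2 * ν * √(p.dl * τ)) _ t :=
    (((hasDerivAt_id t).const_mul p.dl).sqrt (mul_pos hdl ht).ne').const_mul (2 * ν)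
  refine h.congr_deriv ?_
  have h1 : 0 < √p.dl := Real.sqrt_pos.2 hdl
  have h2 : 0 < √t := Real.sqrt_pos.2 ht
  have h3 := Real.sq_sqrt hdl.le
  simp only [id_eq]
  rw [Real.sqrt_mul hdl.le]
  field_simp
  linear_combination -ν * h3

/-- For the explicit temperatures the Stefan condition is the front equation. -/
theorem stefan_iff (hα : 0 < p.α) (hγ : 0 < p.γ) (hkl : 0 < p.kl) (hdl : 0 < p.dl)
    (hds : 0 < p.ds) {ν t : ℝ} (hν : 0 < ν) (ht : 0 < t) :
    p.ks * (t ^ (p.α / 2) * (p.Fs ν / kummerM (p.α / 2 + 1 / 2) (1 / 2) ((ν * p.ω) ^ 2)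
          / (2 * √(p.ds * t))))
        - p.kl * (t ^ (p.α / 2) * (p.Fl ν / kummerM (p.α / 2 + 1 / 2) (1 / 2) (ν ^ 2)
          / (2 * √(p.dl * t))))
        = p.γ * p.front ν t ^ p.α * (ν * √p.dl / √t)
      ↔ p.FrontEquation ν := by
  have h1 : 0 < √p.dl := Real.sqrt_pos.2 hdl
  have h2 : 0 < √t := Real.sqrt_pos.2 ht
  have h3 : 0 < √p.ds := Real.sqrt_pos.2 hds
  have hK : 0 < t ^ (p.α / 2) := by positivity
  have hfront : p.front ν t ^ p.α
      = (2 : ℝ) ^ p.α * ν ^ p.α * p.dl ^ (p.α / 2) * t ^ (p.α / 2) := by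
    rw [front, Real.sqrt_mul hdl.le, Real.mul_rpow (by positivity) (by positivity),
      Real.mul_rpow zero_le_two hν.le, Real.mul_rpow h1.le h2.le, Real.sqrt_eq_rpow,
      Real.sqrt_eq_rpow, ← Real.rpow_mul hdl.le, ← Real.rpow_mul ht.le,
      show 1 / 2 * p.α = p.α / 2 by ring]
    ring
  have hdl' : p.dl ^ ((p.α + 1) / 2) = p.dl ^ (p.α / 2) * √p.dl := by
    rw [add_div, Real.rpow_add hdl, Real.sqrt_eq_rpow]
  have hds' : p.ds ^ ((p.α - 1) / 2) = p.ds ^ (p.α / 2) / √p.ds := by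
    rw [sub_div, Real.rpow_sub hds, Real.sqrt_eq_rpow]
  have hA : 0 < (2 : ℝ) ^ p.α := by positivity
  have hB : 0 < p.dl ^ (p.α / 2) := by positivity
  have hC : 0 < p.ds ^ (p.α / 2) := by positivity
  rw [Fs_div_kummerM hα, Fl_div_kummerM hα hkl, hfront, FrontEquation, hdl', hds',
    Real.sqrt_mul hdl.le, Real.sqrt_mul hds.le, Real.rpow_add_one two_ne_zero,
    Real.rpow_add_one hν.ne']
  generalize t ^ (p.α / 2) = K at *
  generalize (2 : ℝ) ^ p.α = A at *
  generalize p.dl ^ (p.α / 2) = B at *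
  generalize p.ds ^ (p.α / 2) = C at *
  generalize ν ^ p.α = V at *
  generalize p.f₁ ν = x₁
  generalize p.f₂ ν = x₂
  have e1 : p.ks * (K * (-(p.Ti * (A * 2) * C * x₁) / (2 * (√p.ds * √t))))
      - p.kl * (K * (-(2 * √p.dl * p.h0 * p.Tinf / p.kl * x₂) / (2 * (√p.dl * √t))))
      = (K * p.γ * A * B * √p.dl / √t)
        * (-(p.ks * p.Ti * (C / √p.ds) / (p.γ * (B * √p.dl))) * x₁
          + p.h0 * p.Tinf / (p.γ * A * (B * √p.dl)) * x₂) := by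
    field_simp
    ring
  have e2 : p.γ * (A * V * B * K) * (ν * √p.dl / √t)
      = (K * p.γ * A * B * √p.dl / √t) * (V * ν) := by
    field_simp
  rw [e1, e2, mul_right_inj' (by positivity)]

end StefanData

/-! ### The explicit solution -/

namespace StefanData

variable {p : StefanData}

theorem hasDerivAt_liquid (ν x t : ℝ) : HasDerivAt (fun y => p.liquid ν y t)
    (t ^ (p.α / 2) * (deriv (profile p.α (p.El ν) (p.Fl ν)) (x / (2 * √(p.dl * t)))
      / (2 * √(p.dl * t)))) x :=
  hasDerivAt_kummerTemperature _ _ _ _ x t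

theorem hasDerivAt_solid (ν x t : ℝ) : HasDerivAt (fun y => p.solid ν y t)
    (t ^ (p.α / 2) * (deriv (profile p.α (p.Es ν) (p.Fs ν)) (x / (2 * √(p.ds * t)))
      / (2 * √(p.ds * t)))) x :=
  hasDerivAt_kummerTemperature _ _ _ _ x t

theorem isSolution_of_frontEquation (hα : 0 < p.α) (hγ : 0 < p.γ) (hkl : 0 < p.kl)
    (hdl : 0 < p.dl) (hds : 0 < p.ds) (hh0 : 0 < p.h0) {ν : ℝ} (hν : 0 < ν)
    (hfe : p.FrontEquation ν) : p.IsSolution (p.front ν) (p.liquid ν) (p.solid ν) := by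
  have hω := omega_pos hdl hds
  have hfront_pos : ∀ t, 0 < t → 0 < p.front ν t := fun t ht => by
    rw [front]
    have := similarityScale_pos hdl ht
    positivity
  have hliq := fun t ht => (liquid_conditions_iff hα hkl hdl hh0 hν (t := t) ht _ _).2 ⟨rfl, rfl⟩
  have hsol := (solid_conditions_iff hα hω hds hν _ _).2 ⟨rfl, rfl⟩
  exact
  { front_zero := by simp [front]
    front_pos := hfront_pos
    front_continuous := by
      have : Continuous fun t => 2 * ν * √(p.dl * t) := by fun_prop
      exact this.continuousOn
    front_differentiable := fun t ht => (hasDerivAt_front hdl ν ht).differentiableAt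
    liquid_regular_x := fun t _ x _ _ => (contDiff_kummerTemperature _ _ _ _ t).contDiffAt
    liquid_regular_t := fun t ht x _ _ => differentiableAt_kummerTemperature_time _ hdl ht _ _ x
    liquid_heat := fun t ht x _ _ => kummerTemperature_heat _ hdl ht _ _ x
    solid_regular_x := fun t _ x _ => (contDiff_kummerTemperature _ _ _ _ t).contDiffAt
    solid_regular_t := fun t ht x _ => differentiableAt_kummerTemperature_time _ hds ht _ _ x
    solid_heat := fun t ht x _ => kummerTemperature_heat _ hds ht _ _ x
    liquid_front := fun t ht => by
      rw [liquid, kummerTemperature_eq, front_div_scale hdl ht, (hliq t ht).1, mul_zero]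
    solid_front := fun t ht => by
      rw [solid, kummerTemperature_eq, front_div_scale_solid hdl hds ht, hsol.1, mul_zero]
    liquid_diff_front := fun t _ => (hasDerivAt_liquid ν _ t).differentiableAt.differentiableWithinAt
    solid_diff_front := fun t _ => (hasDerivAt_solid ν _ t).differentiableAt.differentiableWithinAt
    stefan := fun t ht => by
      rw [(hasDerivAt_solid ν _ t).hasDerivWithinAt.derivWithin (uniqueDiffOn_Ici _ _ self_mem_Ici),
        (hasDerivAt_liquid ν _ t).hasDerivWithinAt.derivWithin
          (uniqueDiffOn_Icc (hfront_pos t ht) _ (right_mem_Icc.2 (hfront_pos t ht).le)),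
        front_div_scale hdl ht, front_div_scale_solid hdl hds ht,
        deriv_profile_of_zero (by linarith) (hliq t ht).1,
        deriv_profile_of_zero (by linarith) hsol.1, (hasDerivAt_front hdl ν ht).deriv]
      exact (stefan_iff hα hγ hkl hdl hds hν ht).2 hfe
    liquid_diff_face := fun t _ => (hasDerivAt_liquid ν _ t).differentiableAt.differentiableWithinAt
    convective := fun t ht => by
      rw [(hasDerivAt_liquid ν _ t).hasDerivWithinAt.derivWithin
          (uniqueDiffOn_Icc (hfront_pos t ht) _ (left_mem_Icc.2 (hfront_pos t ht).le)),
        liquid, kummerTemperature_eq, zero_div, deriv_profile_zero, profile_zero]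
      exact (hliq t ht).2
    initial := fun x hx => by
      have h := tendsto_kummerTemperature hα hds hx (p.Es ν) (p.Fs ν)
      rw [hsol.2] at h
      have hs : 0 < √p.ds := Real.sqrt_pos.2 hds
      have e : (x / (2 * √p.ds)) ^ p.α * (-p.Ti * (2 * √p.ds) ^ p.α) = -p.Ti * x ^ p.α := by
        rw [Real.div_rpow hx.le (by positivity)]
        have : 0 < (2 * √p.ds) ^ p.α := by positivity
        field_simp
      rwa [e] at h }

theorem isSimilarityType_explicit (ν : ℝ) :
    p.IsSimilarityType (p.front ν) (p.liquid ν) (p.solid ν) :=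
  ⟨profile p.α (p.El ν) (p.Fl ν), profile p.α (p.Es ν) (p.Fs ν), fun t _ =>
    ⟨fun x _ _ => kummerTemperature_eq _ _ _ _ x t, fun x _ => kummerTemperature_eq _ _ _ _ x t⟩⟩

/-! ### Uniqueness -/

section Uniqueness

variable {s : ℝ → ℝ} {Ψl Ψs : ℝ → ℝ → ℝ} {fl fs : ℝ → ℝ}

/-- At each time the boundary conditions at `x = 0` and at the front determine the liquid profile
in terms of the position of the front. -/
theorem IsSolution.liquid_profile (h : p.IsSolution s Ψl Ψs) (hα : 0 < p.α) (hkl : 0 < p.kl)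
    (hdl : 0 < p.dl) (hh0 : 0 < p.h0)
    (hfl : ∀ t, 0 < t → ∀ x, 0 ≤ x → x ≤ s t →
      Ψl x t = t ^ (p.α / 2) * fl (x / (2 * √(p.dl * t))))
    {ν t : ℝ} (ht : 0 < t) (hν : s t = p.front ν t) :
    0 < ν ∧ EqOn fl (profile p.α (p.El ν) (p.Fl ν)) (Icc 0 ν) := by
  have hc := similarityScale_pos hdl ht
  have hK : 0 < t ^ (p.α / 2) := Real.rpow_pos_of_pos ht _
  have hst := h.front_pos t ht
  have hν' : s t = ν * (2 * √(p.dl * t)) := by rw [hν, front]; ring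
  have hνp : 0 < ν := by
    rw [hν'] at hst
    exact pos_of_mul_pos_left hst hc.le
  have hode : SimilarityODE p.α (Ioo 0 ν) fl := by
    have key : ∀ η ∈ Ioo 0 ν, HasDerivAt fl (deriv fl η) η ∧
        HasDerivAt (deriv fl) (2 * p.α * fl η - 2 * η * deriv fl η) η := by
      intro η hη
      have hx0 : 0 < η * (2 * √(p.dl * t)) := mul_pos hη.1 hc
      have hx1 : η * (2 * √(p.dl * t)) < s t := by
        rw [hν']
        exact mul_lt_mul_of_pos_right hη.2 hc
      have hspace : ∀ᶠ y in 𝓝 (η * (2 * √(p.dl * t))),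
          Ψl y t = t ^ (p.α / 2) * fl (y / (2 * √(p.dl * t))) := by
        filter_upwards [Ioo_mem_nhds hx0 hx1] with y hy
        exact hfl t ht y hy.1.le hy.2.le
      have htime : ∀ᶠ τ in 𝓝 t, Ψl (η * (2 * √(p.dl * t))) τ
          = τ ^ (p.α / 2) * fl (η * (2 * √(p.dl * t)) / (2 * √(p.dl * τ))) := by
        filter_upwards [eventually_gt_nhds ht,
          (h.front_differentiable t ht).continuousAt.eventually_const_lt hx1] with τ hτ hτs
        exact hfl τ hτ _ hx0.le hτs.le
      have hres := similarity_profile_ode hdl ht hspace htime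
        (h.liquid_regular_x t ht _ hx0 hx1) (h.liquid_heat t ht _ hx0 hx1)
      rwa [mul_div_cancel_right₀ _ hc.ne'] at hres
    exact ⟨fun η hη => (key η hη).1, fun η hη => (key η hη).2⟩
  have hfl' : ∀ η ∈ Icc 0 ν, fl η = (t ^ (p.α / 2))⁻¹ * Ψl (η * (2 * √(p.dl * t))) t := by
    intro η hη
    rw [hfl t ht _ (mul_nonneg hη.1 hc.le)
      (by rw [hν']; exact mul_le_mul_of_nonneg_right hη.2 hc.le),
      mul_div_cancel_right₀ _ hc.ne', inv_mul_cancel_left₀ hK.ne']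
  have hcΨ : ContinuousOn (fun y => Ψl y t) (Icc 0 (s t)) := by
    intro x hx
    rcases hx.1.eq_or_lt with h0 | h0
    · rw [← h0]
      exact (h.liquid_diff_face t ht).continuousWithinAt
    · rcases hx.2.eq_or_lt with h1 | h1
      · rw [h1]
        exact (h.liquid_diff_front t ht).continuousWithinAt
      · exact (h.liquid_regular_x t ht x h0 h1).continuousAt.continuousWithinAt
  have hcont : ContinuousOn fl (Icc 0 ν) := by
    refine ContinuousOn.congr (continuousOn_const.mul (hcΨ.comp
      (f := fun η => η * (2 * √(p.dl * t))) (by fun_prop) fun η hη => ?_)) hfl'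
    exact ⟨mul_nonneg hη.1 hc.le, by rw [hν']; exact mul_le_mul_of_nonneg_right hη.2 hc.le⟩
  obtain ⟨E, F, hEF⟩ := hode.exists_eqOn_profile isOpen_Ioo isPreconnected_Ioo
    Ioo_subset_Icc_self (closure_Ioo hνp.ne).ge hcont
  have hΨ : EqOn (fun y => Ψl y t) (fun y => kummerTemperature p.α p.dl E F y t)
      (Icc 0 (s t)) := by
    intro x hx
    have hx' : x / (2 * √(p.dl * t)) ∈ Icc 0 ν :=
      ⟨div_nonneg hx.1 hc.le, by rw [div_le_iff₀ hc, ← hν']; exact hx.2⟩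
    simp only [kummerTemperature_eq]
    rw [hfl t ht x hx.1 hx.2, hEF hx']
  have hl : (0 : ℝ) ∈ Icc 0 (s t) := left_mem_Icc.2 hst.le
  have h1 : profile p.α E F ν = 0 := by
    have h2 := hΨ (right_mem_Icc.2 hst.le)
    simp only [h.liquid_front t ht, kummerTemperature_eq] at h2
    rw [hν, front_div_scale hdl ht] at h2
    exact (mul_eq_zero.1 h2.symm).resolve_left hK.ne'
  have h2 := h.convective t ht
  rw [derivWithin_congr hΨ (hΨ hl),
    (hasDerivAt_kummerTemperature p.α p.dl E F 0 t).hasDerivWithinAt.derivWithin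
      (uniqueDiffOn_Icc hst _ hl), show Ψl 0 t = _ from hΨ hl] at h2
  simp only [kummerTemperature_eq, zero_div, deriv_profile_zero, profile_zero] at h2
  obtain ⟨rfl, rfl⟩ := (liquid_conditions_iff hα hkl hdl hh0 hνp ht E F).1 ⟨h1, h2⟩
  exact ⟨hνp, hEF⟩

/-- A nontrivial liquid profile has only one zero, so the front moves as `√t`. -/
theorem IsSolution.exists_front (h : p.IsSolution s Ψl Ψs) (hα : 0 < p.α) (hkl : 0 < p.kl)
    (hdl : 0 < p.dl) (hTinf : 0 < p.Tinf) (hh0 : 0 < p.h0)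
    (hfl : ∀ t, 0 < t → ∀ x, 0 ≤ x → x ≤ s t →
      Ψl x t = t ^ (p.α / 2) * fl (x / (2 * √(p.dl * t)))) :
    ∃ ν, 0 < ν ∧ ∀ t, 0 < t → s t = p.front ν t := by
  set μ : ℝ → ℝ := fun t => s t / (2 * √(p.dl * t)) with hμ
  have hs : ∀ t, 0 < t → s t = p.front (μ t) t := fun t ht => by
    have := similarityScale_pos hdl ht
    simp only [hμ, front]
    field_simp
  have hprof := fun t ht => h.liquid_profile hα hkl hdl hh0 hfl (t := t) ht (hs t ht)
  have hfl_zero : ∀ t, 0 < t → fl (μ t) = 0 := fun t ht => by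
    rw [(hprof t ht).2 (right_mem_Icc.2 (hprof t ht).1.le)]
    exact ((liquid_conditions_iff hα hkl hdl hh0 (hprof t ht).1 ht _ _).2 ⟨rfl, rfl⟩).1
  have hle : ∀ t, 0 < t → ∀ τ, 0 < τ → μ τ ≤ μ t := by
    intro t ht τ hτ
    by_contra! hlt
    obtain ⟨hpos, heq⟩ := hprof τ hτ
    have h1 := hfl_zero t ht
    have h2 := hfl_zero τ hτ
    rw [heq ⟨(hprof t ht).1.le, hlt.le⟩, profile] at h1
    rw [heq (right_mem_Icc.2 hpos.le), profile] at h2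
    have h3 : p.Fl (μ τ) * (oddSol p.α (μ τ) * evenSol p.α (μ t)
        - oddSol p.α (μ t) * evenSol p.α (μ τ)) = 0 := by
      linear_combination evenSol p.α (μ t) * h2 - evenSol p.α (μ τ) * h1
    have h4 := oddSol_mul_evenSol_lt (α := p.α) (by linarith) hlt
    rcases mul_eq_zero.1 h3 with h5 | h5
    · exact (Fl_neg hα hkl hdl hTinf hh0 hpos).ne h5
    · linarith
  refine ⟨μ 1, (hprof 1 one_pos).1, fun t ht => ?_⟩
  rw [hs t ht, le_antisymm (hle 1 one_pos t ht) (hle t ht 1 one_pos)]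

/-- The front condition and the initial condition determine the solid profile in terms of the
front. -/
theorem IsSolution.solid_profile (h : p.IsSolution s Ψl Ψs) (hα : 0 < p.α)
    (hdl : 0 < p.dl) (hds : 0 < p.ds)
    (hfs : ∀ t, 0 < t → ∀ x, s t ≤ x →
      Ψs x t = t ^ (p.α / 2) * fs (x / (2 * √(p.ds * t))))
    {ν : ℝ} (hν : 0 < ν) (hs : ∀ t, 0 < t → s t = p.front ν t) :
    EqOn fs (profile p.α (p.Es ν) (p.Fs ν)) (Ici (ν * p.ω)) := by
  have hω := omega_pos hdl hds
  -- The profile does not depend on the time, so it may be examined at `t = 1`.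
  have h1 : (0 : ℝ) < 1 := one_pos
  have hc := similarityScale_pos hds h1
  have hs1 : s 1 = ν * p.ω * (2 * √(p.ds * 1)) := by
    rw [hs 1 h1, ← front_div_scale_solid hdl hds h1, div_mul_cancel₀ _ hc.ne']
  have hode : SimilarityODE p.α (Ioi (ν * p.ω)) fs := by
    have key : ∀ η ∈ Ioi (ν * p.ω), HasDerivAt fs (deriv fs η) η ∧
        HasDerivAt (deriv fs) (2 * p.α * fs η - 2 * η * deriv fs η) η := by
      intro η hη
      have hx1 : s 1 < η * (2 * √(p.ds * 1)) := by
        rw [hs1]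
        exact mul_lt_mul_of_pos_right hη hc
      have hspace : ∀ᶠ y in 𝓝 (η * (2 * √(p.ds * 1))),
          Ψs y 1 = 1 ^ (p.α / 2) * fs (y / (2 * √(p.ds * 1))) := by
        filter_upwards [Ioi_mem_nhds hx1] with y hy
        exact hfs 1 h1 y (le_of_lt hy)
      have htime : ∀ᶠ τ in 𝓝 1, Ψs (η * (2 * √(p.ds * 1))) τ
          = τ ^ (p.α / 2) * fs (η * (2 * √(p.ds * 1)) / (2 * √(p.ds * τ))) := by
        filter_upwards [eventually_gt_nhds h1,
          (h.front_differentiable 1 h1).continuousAt.eventually_lt_const hx1] with τ hτ hτs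
        exact hfs τ hτ _ hτs.le
      have hres := similarity_profile_ode hds h1 hspace htime
        (h.solid_regular_x 1 h1 _ hx1) (h.solid_heat 1 h1 _ hx1)
      rwa [mul_div_cancel_right₀ _ hc.ne'] at hres
    exact ⟨fun η hη => (key η hη).1, fun η hη => (key η hη).2⟩
  have hfs' : ∀ η ∈ Ici (ν * p.ω), fs η = Ψs (η * (2 * √(p.ds * 1))) 1 := by
    intro η hη
    rw [hfs 1 h1 _ (by rw [hs1]; exact mul_le_mul_of_nonneg_right hη hc.le),
      mul_div_cancel_right₀ _ hc.ne', Real.one_rpow, one_mul]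
  have hcΨ : ContinuousOn (fun y => Ψs y 1) (Ici (s 1)) := by
    intro x hx
    rcases (mem_Ici.1 hx).eq_or_lt with h0 | h0
    · rw [← h0]
      exact (h.solid_diff_front 1 h1).continuousWithinAt
    · exact (h.solid_regular_x 1 h1 x h0).continuousAt.continuousWithinAt
  have hcont : ContinuousOn fs (Ici (ν * p.ω)) := by
    refine ContinuousOn.congr (hcΨ.comp
      (f := fun η => η * (2 * √(p.ds * 1))) (by fun_prop) fun η hη => ?_) hfs'
    rw [hs1]
    exact mul_le_mul_of_nonneg_right hη hc.le
  obtain ⟨E, F, hEF⟩ := hode.exists_eqOn_profile isOpen_Ioi isPreconnected_Ioi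
    Ioi_subset_Ici_self (closure_Ioi _).ge hcont
  have hz : profile p.α E F (ν * p.ω) = 0 := by
    rw [← hEF self_mem_Ici, hfs' _ self_mem_Ici, ← hs1, h.solid_front 1 h1]
  have hinit : (E / Real.Gamma (p.α / 2 + 1 / 2) + F / (2 * Real.Gamma (p.α / 2 + 1))) * √Real.pi
      = -p.Ti * (2 * √p.ds) ^ p.α := by
    have hsq : 0 < √p.ds := Real.sqrt_pos.2 hds
    have hx : 0 < 2 * √p.ds := by positivity
    have hlim := tendsto_kummerTemperature hα hds hx E F
    rw [div_self hx.ne', Real.one_rpow, one_mul] at hlim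
    refine tendsto_nhds_unique (hlim.congr' ?_) (h.initial _ hx)
    have hs0 : Tendsto s (𝓝[>] 0) (𝓝 0) := by
      have := (h.front_continuous 0 self_mem_Ici).tendsto
      rw [h.front_zero] at this
      exact this.mono_left (nhdsWithin_mono _ Ioi_subset_Ici_self)
    filter_upwards [self_mem_nhdsWithin, hs0.eventually_le_const hx] with t ht hts
    have hct := similarityScale_pos hds (mem_Ioi.1 ht)
    rw [kummerTemperature_eq, hfs t ht _ hts, hEF]
    rw [mem_Ici, le_div_iff₀ hct, ← front_div_scale_solid hdl hds (ν := ν) (mem_Ioi.1 ht),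
      div_mul_cancel₀ _ hct.ne', ← hs t ht]
    exact hts
  obtain ⟨rfl, rfl⟩ := (solid_conditions_iff hα hω hds hν E F).1 ⟨hz, hinit⟩
  exact hEF

/-- Every similarity solution is the explicit one for some root of the front equation, which is
the Stefan condition at a single time. -/
theorem IsSolution.eq_explicit (h : p.IsSolution s Ψl Ψs) (hsim : p.IsSimilarityType s Ψl Ψs)
    (hα : 0 < p.α) (hγ : 0 < p.γ) (hkl : 0 < p.kl) (hdl : 0 < p.dl) (hds : 0 < p.ds)
    (hTinf : 0 < p.Tinf) (hh0 : 0 < p.h0) :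
    ∃ ν, 0 < ν ∧ p.FrontEquation ν ∧ (∀ t, 0 ≤ t → s t = p.front ν t) ∧
      (∀ t, 0 < t → ∀ x, 0 ≤ x → x ≤ s t → Ψl x t = p.liquid ν x t) ∧
      (∀ t, 0 < t → ∀ x, s t ≤ x → Ψs x t = p.solid ν x t) := by
  obtain ⟨fl, fs, hf⟩ := hsim
  have hfl := fun t ht => (hf t ht).1
  have hfs := fun t ht => (hf t ht).2
  have hω := omega_pos hdl hds
  obtain ⟨ν, hν, hs⟩ := h.exists_front hα hkl hdl hTinf hh0 hfl
  have hsol := h.solid_profile hα hdl hds hfs hν hs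
  have hΨl : ∀ t, 0 < t → EqOn (fun y => Ψl y t) (fun y => p.liquid ν y t) (Icc 0 (s t)) := by
    intro t ht x hx
    have hc := similarityScale_pos hdl ht
    simp only [liquid, kummerTemperature_eq]
    rw [hfl t ht x hx.1 hx.2, (h.liquid_profile hα hkl hdl hh0 hfl ht (hs t ht)).2]
    refine ⟨div_nonneg hx.1 hc.le, ?_⟩
    rw [← front_div_scale hdl (ν := ν) ht, ← hs t ht]
    exact div_le_div_of_nonneg_right hx.2 hc.le
  have hΨs : ∀ t, 0 < t → EqOn (fun y => Ψs y t) (fun y => p.solid ν y t) (Ici (s t)) := by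
    intro t ht x hx
    have hc := similarityScale_pos hds ht
    simp only [solid, kummerTemperature_eq]
    rw [hfs t ht x hx, hsol]
    rw [mem_Ici, ← front_div_scale_solid hdl hds (ν := ν) ht, ← hs t ht]
    exact div_le_div_of_nonneg_right hx hc.le
  refine ⟨ν, hν, ?_, ?_, fun t ht x h0 h1 => hΨl t ht ⟨h0, h1⟩, fun t ht x hx => hΨs t ht hx⟩
  · have ht : (0 : ℝ) < 1 := one_pos
    have hst := h.front_pos 1 ht
    have hstefan := h.stefan 1 ht
    have hds1 : deriv s 1 = ν * √p.dl / √1 := by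
      have heq : s =ᶠ[𝓝 1] p.front ν := (eventually_gt_nhds ht).mono fun τ hτ => hs τ hτ
      rw [heq.deriv_eq, (hasDerivAt_front hdl ν ht).deriv]
    have hr : s 1 ∈ Icc 0 (s 1) := right_mem_Icc.2 hst.le
    rw [derivWithin_congr (hΨl 1 ht) (hΨl 1 ht hr), derivWithin_congr (hΨs 1 ht)
      (hΨs 1 ht self_mem_Ici), hds1,
      (hasDerivAt_liquid ν _ 1).hasDerivWithinAt.derivWithin
        (uniqueDiffOn_Icc hst _ hr),
      (hasDerivAt_solid ν _ 1).hasDerivWithinAt.derivWithin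
        (uniqueDiffOn_Ici _ _ self_mem_Ici), hs 1 ht,
      front_div_scale hdl ht, front_div_scale_solid hdl hds ht,
      deriv_profile_of_zero (by linarith)
        ((liquid_conditions_iff hα hkl hdl hh0 hν ht _ _).2 ⟨rfl, rfl⟩).1,
      deriv_profile_of_zero (by linarith)
        ((solid_conditions_iff hα hω hds hν _ _).2 ⟨rfl, rfl⟩).1] at hstefan
    exact (stefan_iff hα hγ hkl hdl hds hν ht).1 hstefan
  · intro t ht
    rcases ht.eq_or_lt with rfl | ht
    · simp [h.front_zero, front]
    · exact hs t ht

end Uniqueness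

end StefanData

end

theorem theorem1 (p : StefanData)
    (hα : 0 < p.α) (hα_nonint : ∀ n : ℤ, p.α ≠ (n : ℝ))
    (hγ : 0 < p.γ) (hkl : 0 < p.kl) (hks : 0 < p.ks) (hdl : 0 < p.dl) (hds : 0 < p.ds)
    (hTi : 0 < p.Ti) (hTinf : 0 < p.Tinf) (hh0_pos : 0 < p.h0)
    (hh0 : (2 : ℝ) ^ p.α * Real.Gamma (p.α / 2 + 1) * p.ks * p.Ti * p.ds ^ ((p.α - 1) / 2)
      / (p.Tinf * √Real.pi) < p.h0) :
    ∃ ν : ℝ, 0 < ν ∧ p.FrontEquation ν ∧ (∀ x : ℝ, 0 < x → p.FrontEquation x → x = ν) ∧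
      p.IsSolution (p.front ν) (p.liquid ν) (p.solid ν) ∧
      p.IsSimilarityType (p.front ν) (p.liquid ν) (p.solid ν) ∧
      (∀ t : ℝ, 0 < t → 0 < p.front ν t) ∧
      ∀ (s : ℝ → ℝ) (Ψl Ψs : ℝ → ℝ → ℝ),
        p.IsSolution s Ψl Ψs → p.IsSimilarityType s Ψl Ψs →
          (∀ t : ℝ, 0 ≤ t → s t = p.front ν t) ∧
          (∀ t : ℝ, 0 < t → ∀ x : ℝ, 0 ≤ x → x ≤ s t → Ψl x t = p.liquid ν x t) ∧
          (∀ t : ℝ, 0 < t → ∀ x : ℝ, s t ≤ x → Ψs x t = p.solid ν x t) := by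
  obtain ⟨ν, hν, hfe, huniq⟩ := StefanData.exists_unique_frontEquation hα hγ hkl hks hdl hds hTi
    hTinf hh0_pos hh0
  have hsol := StefanData.isSolution_of_frontEquation hα hγ hkl hdl hds hh0_pos hν hfe
  refine ⟨ν, hν, hfe, huniq, hsol, StefanData.isSimilarityType_explicit ν, hsol.front_pos, ?_⟩
  intro s Ψl Ψs h hsim
  obtain ⟨ν', hν', hfe', hres⟩ := h.eq_explicit hsim hα hγ hkl hdl hds hTinf hh0_pos
  obtain rfl := huniq ν' hν' hfe'
  exact hres
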